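/- **Setting.** Let $d\in\mathbb N$ be fixed. For each number of nodes $n$ let $K_n,T_n\in\mathbb N$ with $\max(K_n,T_n)=O(\log n)$ as $n\to\infty$, and let $\rho_n\in(0,1]$ satisfy $\rho_n=\omega\{\log^c(n)\,n^{-1/2}\}$ for some $c\ge 4$ (this covers the dense regime $\rho_n=1$ and the sparse regime $\rho_n\to0$). For each $n$ let $\mathcal X^1,\dots,\mathcal X^{K_n},\mathcal Y^1,\dots,\mathcal Y^{T_n}\subseteq\mathbb R^d$ (allowed to depend on $n$) be such that $x^\top y\in[0,1]$ for all $x\in\mathcal X^k$, $y\in\mathcal Y^t$, and let $F$ (depending on $n$) be any probability distribution on $\bigl[\prod_{k=1}^{K_n}\prod_{i=1}^n\mathcal X^k\bigr]\times\bigl[\prod_{t=1}^{T_n}\prod_{j=1}^n\mathcal Y^t\bigr]$. Let $F_\rho$ be the distribution of $(\rho_n^{1/2}\xi,\rho_n^{1/2}\nu)$ when $(\xi,\nu)\sim F$. Let $(\mathbf A,\mathbf X,\mathbf Y)\sim\mathrm{DMPRDPG}(F_\rho)$. That is, the latent positions $(X_i^k)_{k\le K_n,\,i\le n}$, $(Y_j^t)_{t\le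 T_n,\,j\le n}$ have joint distribution $F_\rho$; the matrices $\mathbf X\in\mathbb R^{nK_n\times d}$ and $\mathbf Y\in\mathbb R^{nT_n\times d}$ have the blocks $X^k$ and $Y^t$ with rows $X_i^k$ and $Y_j^t$; $\mathbf A\in\{0,1\}^{nK_n\times nT_n}$ is the random block matrix whose block in position $(k,t)$ is $A^{k,t}\in\{0,1\}^{n\times n}$; and, conditionally on $(\mathbf X,\mathbf Y)$, the entries $A^{k,t}_{i,j}$ with $i\ne j$, $k\le K_n$, $t\le T_n$ are independent with $A^{k,t}_{i,j}\sim\mathrm{Bernoulli}\bigl((X_i^k)^\top Y_j^t\bigr)$. The diagonal entries $A^{k,t}_{i,i}\in\{0,1\}$ are arbitrary. Put $\mathbf P=\mathbf X\mathbf Y^\top$. **Proposition (bound for the "variance" of $\mathbf A$).** With $\|\cdot\|$ the spectral norm, $$\|\mathbf A-\mathbf P\| = O_{\mathbb P}\bigl\{\rho_n^{1/2}\max(K_n,T_n)^{1/2}\,n^{1/2}\log^{1/2}(n)\bigr\}.$$ Here $|Z_n|=O_{\mathbb P}(f(n))$ means that there are $n^\ast\in\mathbb N$ and a constant $C>0$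 such that the event $|Z_n|\le Cf(n)$ holds with overwhelming probability for $n\ge n^\ast$: for every $\gamma>0$ there is $C_\gamma>0$, independent of $n$, with $\mathbb P\{|Z_n|\le Cf(n)\}\ge 1-C_\gamma n^{-\gamma}$ for all $n\ge n^\ast$. -/

import Mathlib

open MeasureTheory Filter Asymptotics

noncomputable section

namespace DMPRDPG

/-! ### Probabilistic asymptotic notation -/

/-- The events `E n` (each in its own probability space) hold with overwhelming probability for all
`n ≥ N`: for every `γ > 0` there is a constant `Cγ > 0`, independent of `n`, such that
`ℙ (E n) ≥ 1 - Cγ n ^ (-γ)` for all `n ≥ N`. -/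
def OverwhelmingFrom {Ω : ℕ → Type*} [∀ n, MeasurableSpace (Ω n)] (μ : ∀ n, Measure (Ω n))
    (E : ∀ n, Set (Ω n)) (N : ℕ) : Prop :=
  ∀ γ : ℝ, 0 < γ → ∃ Cγ : ℝ, 0 < Cγ ∧
    ∀ n : ℕ, N ≤ n → 1 - Cγ * (n : ℝ) ^ (-γ) ≤ (μ n).real (E n)

/-- `|Z| = O_ℙ(f)`: there are `N` and one constant `C > 0` such that the event `|Z n| ≤ C f(n)`
holds with overwhelming probability for all `n ≥ N`. The constant `C` does not depend on the
exponent `γ` of the overwhelming probability. -/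
def IsBigOP {Ω : ℕ → Type*} [∀ n, MeasurableSpace (Ω n)] (μ : ∀ n, Measure (Ω n))
    (Z : ∀ n, Ω n → ℝ) (f : ℕ → ℝ) : Prop :=
  ∃ N : ℕ, ∃ C : ℝ, 0 < C ∧ OverwhelmingFrom μ (fun n => {ω | |Z n ω| ≤ C * f n}) N

/-! ### Matrices -/

/-- The spectral norm of a rectangular real matrix: its operator norm with respect to the Euclidean
norms, that is, its largest singular value. -/
def specNorm {m m' : Type*} [Fintype m] [Fintype m'] [DecidableEq m'] (M : Matrix m m' ℝ) : ℝ :=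
  ‖(Matrix.toEuclideanLin M).toContinuousLinearMap‖

/-- Latent positions in `ℝ^d` of `n` nodes in each of `r` groups (layers or time points):
`x k i` is the position of node `i` in group `k`. -/
abbrev Positions (r n d : ℕ) : Type := Fin r → Fin n → Fin d → ℝ

/-- Vertical stacking of the `r` matrices of size `n × d` into a matrix of size `n r × d`; row `i` of
block `k` has the index `(k, i)`. -/
def stack {r n d : ℕ} (x : Positions r n d) : Matrix (Fin r × Fin n) (Fin d) ℝ :=
  Matrix.of fun p l => x p.1 p.2 l

/-- The doubly unfolded matrix, of size `n K × n T`, whose block in position `(k, t)` is `B k t`. -/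
def unfold {K T n : ℕ} (B : Fin K → Fin T → Matrix (Fin n) (Fin n) ℝ) :
    Matrix (Fin K × Fin n) (Fin T × Fin n) ℝ :=
  Matrix.of fun p q => B p.1 q.1 p.2 q.2

/-- The doubly unfolded probability matrix `P = X Yᵀ`. -/
def probMatrix {K T n d : ℕ} (x : Positions K n d) (y : Positions T n d) :
    Matrix (Fin K × Fin n) (Fin T × Fin n) ℝ :=
  stack x * (stack y).transpose

/-! ### The model -/

/-- `F` is a probability distribution on the product of `n` copies of each of the latent spaces
`𝒳 1, …, 𝒳 K, 𝒴 1, …, 𝒴 T ⊆ ℝ^d`, and `xᵀ y ∈ [0,1]` for all `x ∈ 𝒳 k` and `y ∈ 𝒴 t`. Any dependence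
between the latent positions is allowed. -/
structure IsLatentDistribution {K T n d : ℕ} (𝒳 : Fin K → Set (Fin d → ℝ))
    (𝒴 : Fin T → Set (Fin d → ℝ)) (F : Measure (Positions K n d × Positions T n d)) : Prop where
  isProbabilityMeasure : IsProbabilityMeasure F
  dotProduct_mem : ∀ k t, ∀ x ∈ 𝒳 k, ∀ y ∈ 𝒴 t, dotProduct x y ∈ Set.Icc (0 : ℝ) 1
  mem_spaces : ∀ᵐ p ∂F, (∀ k i, p.1 k i ∈ 𝒳 k) ∧ (∀ t j, p.2 t j ∈ 𝒴 t)

/-- The distribution `F_ρ` of `(ρ^{1/2} ξ, ρ^{1/2} ν)` when `(ξ, ν) ∼ F`. -/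
def scaled {K T n d : ℕ} (F : Measure (Positions K n d × Positions T n d)) (ρ : ℝ) :
    Measure (Positions K n d × Positions T n d) :=
  F.map fun p => (ρ ^ (1 / 2 : ℝ) • p.1, ρ ^ (1 / 2 : ℝ) • p.2)

/-- `(A, X, Y) ∼ DMPRDPG(F)`: the latent positions `(X, Y)` have distribution `F`, the matrices
`A k t` are random with entries in `{0,1}`, and conditionally on the latent positions the
off-diagonal entries of all the `A k t` are independent, with
`A k t i j ∼ Bernoulli ((X k i)ᵀ (Y t j))`. As all these entries are `{0,1}`-valued, the last
property says that their joint conditional mass function is the product of the Bernoulli mass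
functions. Nothing is required of the diagonal entries, except that they take values in `{0,1}`. -/
structure IsDMPRDPG {K T n d : ℕ} {Ω : Type*} [MeasurableSpace Ω] (μ : Measure Ω)
    (F : Measure (Positions K n d × Positions T n d))
    (A : Ω → Fin K → Fin T → Matrix (Fin n) (Fin n) ℝ)
    (X : Ω → Positions K n d) (Y : Ω → Positions T n d) : Prop where
  measurable_X : Measurable X
  measurable_Y : Measurable Y
  law_latent : μ.map (fun ω => (X ω, Y ω)) = F
  measurable_A : ∀ k t i j, Measurable fun ω => A ω k t i j
  binary_A : ∀ ω k t i j, A ω k t i j = 0 ∨ A ω k t i j = 1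
  cond_law_A : ∀ a : Fin K → Fin T → Fin n → Fin n → Bool,
    μ[Set.indicator {ω | ∀ k t i j, i ≠ j → A ω k t i j = if a k t i j then 1 else 0}
        (fun _ => (1 : ℝ)) | MeasurableSpace.comap (fun ω => (X ω, Y ω)) inferInstance]
      =ᵐ[μ] fun ω => ∏ k, ∏ t, ∏ i, ∏ j ∈ Finset.univ.filter (fun j => i ≠ j),
        if a k t i j then dotProduct (X ω k i) (Y ω t j) else 1 - dotProduct (X ω k i) (Y ω t j)

end DMPRDPG

end

/-! Conditionally on the latent positions, the off-diagonal part of the noise is a matrix of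
independent centered Bernoulli variables with success probabilities at most ρ. Write m for max(K,
T), R for ρmn, which bounds all row and column sums of the probabilities, and f for the rate √(R log
n). The tail of the spectral norm is estimated on a finite cube, uniformly in the probabilities, and
then integrated over the latent positions.

Size of the norm (`expect_specNorm_pow_le`): let X be the symmetric dilation of the noise. Expanding
one factor of tr X^(2q) over the entries and integrating each entry by parts leaves differences of
odd powers of two matrices that differ in one entry. A trace inequality bounds these by diagonal
entries of X^(2q-2). Young's inequality absorbs half of tr X^(2q); what remains are moments of row
and column sums, of order R^q when q ≤ R. Hence E‖·‖^(2q) is at most about (dimension)·(C q R)^q.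
With q of order log n the dimension costs a constant factor, and some M of order f satisfies ‖·‖ ≤ M
with probability at least 1/2. The factor log n in the rate is this q.

Deviations (`prob_mul_prob_le`): Markov with larger moments would make the constant depend on γ.
Instead, the norm is a convex 1-Lipschitz function of the entries, so Talagrand's inequality,
obtained here from Maurey's infimum convolution, gives P(‖·‖ ≥ M + t) ≤ 2 exp(-t²/16). For t = f one
has t² ≥ √n eventually, which beats every power of n with one fixed constant.

The arbitrary diagonals of the blocks contribute at most m to the norm. Since m = O(log n) and ρn ≥
1, also m = O(f). -/

namespace BernoulliCube

/-! ### Product Bernoulli measures on the finite cube -/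

variable {I : Type*} [Fintype I]

/-- The mass function of independent Bernoulli variables with success probabilities `p`. -/
noncomputable def weight (p : I → ℝ) (a : I → Bool) : ℝ := ∏ i, if a i then p i else 1 - p i

theorem weight_nonneg {p : I → ℝ} (hp : ∀ i, p i ∈ Set.Icc (0 : ℝ) 1) (a : I → Bool) :
    0 ≤ weight p a :=
  Finset.prod_nonneg fun i _ => by
    have := hp i
    split_ifs
    · exact this.1
    · linarith [this.2]

variable [DecidableEq I]

/-- The expectation over independent Bernoulli variables with success probabilities `p`. -/
noncomputable def expect (p : I → ℝ) (φ : (I → Bool) → ℝ) : ℝ := ∑ a, weight p a * φ a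

/-- The real vector with entries `0` and `1` of a vertex of the cube. -/
def toReal (a : I → Bool) (i : I) : ℝ := if a i then 1 else 0

theorem expect_prod (p : I → ℝ) (g : I → Bool → ℝ) :
    expect p (fun a => ∏ i, g i (a i)) = ∏ i, (p i * g i true + (1 - p i) * g i false) := by
  have h := Finset.prod_univ_sum (fun _ : I => (Finset.univ : Finset Bool))
    (fun i b => (if b then p i else 1 - p i) * g i b)
  rw [Fintype.piFinset_univ] at h
  simp only [Fintype.sum_bool, if_true, Bool.false_eq_true, if_false] at h
  rw [h]
  simp only [expect, weight, Finset.prod_mul_distrib]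

theorem sum_weight (p : I → ℝ) : ∑ a, weight p a = 1 := by
  have := expect_prod p (fun _ _ => 1)
  simpa [expect] using this

theorem expect_const (p : I → ℝ) (c : ℝ) : expect p (fun _ => c) = c := by
  rw [expect, ← Finset.sum_mul, sum_weight, one_mul]

theorem expect_mono {p : I → ℝ} (hp : ∀ i, p i ∈ Set.Icc (0 : ℝ) 1) {φ ψ : (I → Bool) → ℝ}
    (h : ∀ a, φ a ≤ ψ a) : expect p φ ≤ expect p ψ :=
  Finset.sum_le_sum fun a _ => mul_le_mul_of_nonneg_left (h a) (weight_nonneg hp a)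

theorem expect_add (p : I → ℝ) (φ ψ : (I → Bool) → ℝ) :
    expect p (fun a => φ a + ψ a) = expect p φ + expect p ψ := by
  simp [expect, mul_add, Finset.sum_add_distrib]

theorem expect_const_mul (p : I → ℝ) (c : ℝ) (φ : (I → Bool) → ℝ) :
    expect p (fun a => c * φ a) = c * expect p φ := by
  simp only [expect, Finset.mul_sum]
  exact Finset.sum_congr rfl fun a _ => by ring

theorem expect_sum (p : I → ℝ) {J : Type*} (s : Finset J) (φ : J → (I → Bool) → ℝ) :
    expect p (fun a => ∑ j ∈ s, φ j a) = ∑ j ∈ s, expect p (φ j) := by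
  simp only [expect, Finset.mul_sum]
  exact Finset.sum_comm

theorem weight_update (p : I → ℝ) (a : I → Bool) (i : I) (b : Bool) :
    weight p (Function.update a i b) =
      (if b then p i else 1 - p i) * ∏ j ∈ Finset.univ.erase i, if a j then p j else 1 - p j := by
  rw [weight, ← Finset.mul_prod_erase _ _ (Finset.mem_univ i), Function.update_self]
  congr 1
  refine Finset.prod_congr rfl fun j hj => ?_
  rw [Function.update_of_ne (Finset.ne_of_mem_erase hj)]

/-- Resampling one coordinate does not change the expectation. -/
theorem expect_resample (p : I → ℝ) (i : I) (φ : (I → Bool) → ℝ) :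
    expect p φ = expect p fun a =>
      p i * φ (Function.update a i true) + (1 - p i) * φ (Function.update a i false) := by
  rw [← sub_eq_zero, expect, expect, ← Finset.sum_sub_distrib]
  -- A vertex and its flip at `i` have the same two resampled vertices, so their weighted
  -- differences cancel in pairs.
  refine Finset.sum_involution (fun a _ => Function.update a i (!(a i))) ?_ ?_ ?_ ?_
  · intro a _
    have h1 := weight_update p a i true
    have h2 := weight_update p a i false
    have ha : Function.update a i (a i) = a := Function.update_eq_self i a
    rcases h : a i with _ | _ <;> rw [h] at ha
    · simp only [Function.update_idem, Bool.not_false]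
      rw [ha] at h2 ⊢
      rw [h1, h2]
      simp
      ring
    · simp only [Function.update_idem, Bool.not_true]
      rw [ha] at h1 ⊢
      rw [h1, h2]
      simp
      ring
  · intro a _ _ h
    have := congrFun h i
    simp at this
  · simp
  · intro a _
    simp

/-- Integration by parts for one Bernoulli variable: its centered values 1 - p and -p, times their
probabilities, are ±p(1 - p). -/
theorem expect_centered_mul (p : I → ℝ) (i : I) (φ : (I → Bool) → ℝ) :
    expect p (fun a => (toReal a i - p i) * φ a) = p i * (1 - p i) *
      expect p fun a => φ (Function.update a i true) - φ (Function.update a i false) := by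
  rw [expect_resample p i, ← expect_const_mul]
  congr 1
  funext a
  simp [toReal]
  ring

/-- Companion of `expect_centered_mul`, read from right to left: a bound on the discrete derivative
by a sum over both values of the coordinate becomes an expectation under the original law. -/
theorem expect_swap_mul (p : I → ℝ) (i : I) (φ : (I → Bool) → ℝ) :
    expect p (fun a => (if a i then 1 - p i else p i) * φ a) = p i * (1 - p i) *
      expect p fun a => φ (Function.update a i true) + φ (Function.update a i false) := by
  rw [expect_resample p i, ← expect_const_mul]
  congr 1
  funext a
  simp
  ring

theorem expect_cons {m : ℕ} (p : Fin (m + 1) → ℝ) (φ : (Fin (m + 1) → Bool) → ℝ) :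
    expect p φ = p 0 * expect (fun i => p i.succ) (fun a => φ (Fin.cons true a)) +
      (1 - p 0) * expect (fun i => p i.succ) (fun a => φ (Fin.cons false a)) := by
  rw [expect, ← (Fin.consEquiv fun _ => Bool).sum_comp, Fintype.sum_prod_type, Fintype.sum_bool]
  simp only [expect, Finset.mul_sum, weight, Fin.consEquiv_apply, Fin.prod_univ_succ, Fin.cons_zero,
    Fin.cons_succ]
  simp only [if_true, Bool.false_eq_true, if_false, mul_assoc]
  rfl

theorem expect_equiv {J : Type*} [Fintype J] [DecidableEq J] (e : J ≃ I) (p : I → ℝ)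
    (φ : (I → Bool) → ℝ) :
    expect p φ = expect (fun j => p (e j)) fun b => φ fun i => b (e.symm i) := by
  rw [expect, expect, ← (e.arrowCongr (Equiv.refl Bool)).sum_comp]
  refine Finset.sum_congr rfl fun b _ => ?_
  congr 1
  rw [weight, weight, ← e.prod_comp]
  simp [Equiv.arrowCongr]

/-! ### Convex infimum convolution -/

theorem exists_exp_le_two_sub_exp_neg {u : ℝ} (hu : 0 ≤ u) :
    ∃ θ ∈ Set.Icc (0 : ℝ) 1, Real.exp (θ ^ 2 / 8 + (1 - θ) * u) ≤ 2 - Real.exp (-u) := by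
  rcases le_total u (1 / 4) with h | h
  -- The exponent is quadratic in θ with minimizer 4u, where it equals u - 2u²; beyond u = 1/4 the
  -- minimizer is clamped to 1.
  · refine ⟨4 * u, ⟨by linarith, by linarith⟩, ?_⟩
    have h1 := (abs_le.1 (Real.abs_exp_sub_one_sub_id_le (x := u - 2 * u ^ 2)
      (abs_le.2 ⟨by nlinarith, by nlinarith⟩))).2
    have h2 := (abs_le.1 (Real.abs_exp_sub_one_sub_id_le (x := -u)
      (abs_le.2 ⟨by linarith, by linarith⟩))).2
    have h3 : (4 * u) ^ 2 / 8 + (1 - 4 * u) * u = u - 2 * u ^ 2 := by ring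
    rw [h3]
    nlinarith [mul_nonneg hu hu, mul_nonneg (mul_nonneg hu hu) hu,
      mul_nonneg (mul_nonneg (mul_nonneg hu hu) hu) (sub_nonneg.2 h)]
  · refine ⟨1, ⟨zero_le_one, le_rfl⟩, ?_⟩
    have h1 := (abs_le.1 (Real.abs_exp_sub_one_sub_id_le (x := 1 / 8)
      (abs_le.2 ⟨by norm_num, by norm_num⟩))).2
    have h2 := (abs_le.1 (Real.abs_exp_sub_one_sub_id_le (x := -(1 / 4))
      (abs_le.2 ⟨by norm_num, by norm_num⟩))).2
    have h3 : Real.exp (-u) ≤ Real.exp (-(1 / 4)) := Real.exp_le_exp.2 (by linarith)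
    have h4 : (1 : ℝ) ^ 2 / 8 + (1 - 1) * u = 1 / 8 := by ring
    rw [h4]
    norm_num at h1 h2
    linarith

/-- One-coordinate case of Maurey's inequality. Take θ = 0 in the bound for G₁ and the best θ in the
bound for G₀. With r = exp(u₀ - u₁) and δ = (1 - p)(1 - r), the product is then at most (1 + δ)(1 -
δ). -/
theorem two_point_of_le {p G₀ G₁ u₀ u₁ : ℝ} (hp : p ∈ Set.Icc (0 : ℝ) 1) (hu : u₀ ≤ u₁)
    (h₁ : ∀ θ ∈ Set.Icc (0 : ℝ) 1, G₁ ≤ Real.exp (θ ^ 2 / 8 - (1 - θ) * u₁ - θ * u₀))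
    (h₀ : ∀ θ ∈ Set.Icc (0 : ℝ) 1, G₀ ≤ Real.exp (θ ^ 2 / 8 - (1 - θ) * u₀ - θ * u₁)) :
    (p * G₁ + (1 - p) * G₀) * (p * Real.exp u₁ + (1 - p) * Real.exp u₀) ≤ 1 := by
  obtain ⟨θ, hθ, h⟩ := exists_exp_le_two_sub_exp_neg (sub_nonneg.2 hu)
  have e₁ : G₁ ≤ Real.exp (-u₁) := by
    simpa using h₁ 0 ⟨le_rfl, zero_le_one⟩
  have e₀ : G₀ ≤ Real.exp (-u₁) * (2 - Real.exp (-(u₁ - u₀))) := by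
    refine (h₀ θ hθ).trans ?_
    refine le_trans (le_of_eq ?_) (mul_le_mul_of_nonneg_left h (Real.exp_pos _).le)
    rw [← Real.exp_add]
    ring_nf
  have e : Real.exp u₀ = Real.exp u₁ * Real.exp (-(u₁ - u₀)) := by
    rw [← Real.exp_add]
    ring_nf
  set r := Real.exp (-(u₁ - u₀))
  have hpos : Real.exp (-u₁) * Real.exp u₁ = 1 := by rw [← Real.exp_add]; simp
  have hr : 0 < r := Real.exp_pos _
  rw [e]
  have hq : 0 ≤ 1 - p := by linarith [hp.2]
  calc _ ≤ (p * Real.exp (-u₁) + (1 - p) * (Real.exp (-u₁) * (2 - r))) *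
        (p * Real.exp u₁ + (1 - p) * (Real.exp u₁ * r)) := by
        refine mul_le_mul_of_nonneg_right ?_ ?_
        · exact add_le_add (mul_le_mul_of_nonneg_left e₁ hp.1) (mul_le_mul_of_nonneg_left e₀ hq)
        · have := hp.1
          positivity
    _ = (Real.exp (-u₁) * Real.exp u₁) * (1 - ((1 - p) * (1 - r)) ^ 2) := by ring
    _ ≤ 1 := by
        rw [hpos]
        nlinarith [sq_nonneg ((1 - p) * (1 - r))]

theorem two_point {p G₀ G₁ u₀ u₁ : ℝ} (hp : p ∈ Set.Icc (0 : ℝ) 1)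
    (h₁ : ∀ θ ∈ Set.Icc (0 : ℝ) 1, G₁ ≤ Real.exp (θ ^ 2 / 8 - (1 - θ) * u₁ - θ * u₀))
    (h₀ : ∀ θ ∈ Set.Icc (0 : ℝ) 1, G₀ ≤ Real.exp (θ ^ 2 / 8 - (1 - θ) * u₀ - θ * u₁)) :
    (p * G₁ + (1 - p) * G₀) * (p * Real.exp u₁ + (1 - p) * Real.exp u₀) ≤ 1 := by
  rcases le_total u₀ u₁ with hu | hu
  · exact two_point_of_le hp hu h₁ h₀
  · have := two_point_of_le (p := 1 - p) ⟨by linarith [hp.2], by linarith [hp.1]⟩ hu h₀ h₁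
    rw [sub_sub_cancel] at this
    linarith

/-- The quadratic infimum convolution of `f`. -/
noncomputable def infConv {I : Type*} [Fintype I] (f : (I → ℝ) → ℝ) (x : I → ℝ) : ℝ :=
  ⨅ y, (f y + (∑ i, (x i - y i) ^ 2) / 8)

theorem infConv_le {I : Type*} [Fintype I] {f : (I → ℝ) → ℝ} (hf : ∀ x, 0 ≤ f x) (x y : I → ℝ) :
    infConv f x ≤ f y + (∑ i, (x i - y i) ^ 2) / 8 := by
  refine ciInf_le ⟨0, ?_⟩ y
  rintro _ ⟨z, rfl⟩
  have := hf z
  positivity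

/-- The recursive estimate of the infimum convolution of a convex function in its first variable. -/
theorem infConv_cons_le {m : ℕ} {f : (Fin (m + 1) → ℝ) → ℝ} (hc : ConvexOn ℝ Set.univ f)
    (hf : ∀ x, 0 ≤ f x) {θ : ℝ} (hθ : θ ∈ Set.Icc (0 : ℝ) 1) (s t : ℝ) (hst : (s - t) ^ 2 ≤ 1)
    (x : Fin m → ℝ) :
    infConv f (Fin.cons s x) ≤ θ ^ 2 / 8 + (1 - θ) * infConv (fun y => f (Fin.cons s y)) x +
      θ * infConv (fun y => f (Fin.cons t y)) x := by
  have h1 : 0 ≤ 1 - θ := by linarith [hθ.2]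
  have key : ∀ y z : Fin m → ℝ, infConv f (Fin.cons s x) ≤ θ ^ 2 / 8 +
      (1 - θ) * (f (Fin.cons s y) + (∑ i, (x i - y i) ^ 2) / 8) +
      θ * (f (Fin.cons t z) + (∑ i, (x i - z i) ^ 2) / 8) := by
    intro y z
    -- The interpolated competitor lies at distance θ|s - t| ≤ θ in the first coordinate; convexity
    -- of f and of the square handles the rest.
    refine (infConv_le hf _ ((1 - θ) • Fin.cons s y + θ • Fin.cons t z)).trans ?_
    have h2 := hc.2 (Set.mem_univ (Fin.cons s y)) (Set.mem_univ (Fin.cons t z)) h1 hθ.1 (by ring)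
    simp only [smul_eq_mul] at h2
    have h3 : ∑ i, ((Fin.cons s x : Fin (m + 1) → ℝ) i -
        ((1 - θ) • (Fin.cons s y : Fin (m + 1) → ℝ) + θ • (Fin.cons t z : Fin (m + 1) → ℝ)) i) ^ 2
        ≤ θ ^ 2 + ((1 - θ) * (∑ i, (x i - y i) ^ 2) + θ * ∑ i, (x i - z i) ^ 2) := by
      rw [Fin.sum_univ_succ, Finset.mul_sum, Finset.mul_sum, ← Finset.sum_add_distrib]
      refine add_le_add ?_ (Finset.sum_le_sum fun i _ => ?_)
      · simp only [Pi.add_apply, Pi.smul_apply, Fin.cons_zero, smul_eq_mul]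
        nlinarith [mul_le_mul_of_nonneg_left hst (sq_nonneg θ)]
      · simp only [Pi.add_apply, Pi.smul_apply, Fin.cons_succ, smul_eq_mul]
        nlinarith [mul_nonneg (mul_nonneg hθ.1 h1) (sq_nonneg (y i - z i))]
    linarith
  have h2 : ∀ z : Fin m → ℝ, infConv f (Fin.cons s x) - θ ^ 2 / 8 -
      θ * (f (Fin.cons t z) + (∑ i, (x i - z i) ^ 2) / 8) ≤
      (1 - θ) * infConv (fun y => f (Fin.cons s y)) x := by
    intro z
    rw [infConv.eq_def (fun y => f (Fin.cons s y)), Real.mul_iInf_of_nonneg h1]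
    exact le_ciInf fun y => by linarith [key y z]
  have h3 : infConv f (Fin.cons s x) - θ ^ 2 / 8 -
      (1 - θ) * infConv (fun y => f (Fin.cons s y)) x ≤
      θ * infConv (fun y => f (Fin.cons t y)) x := by
    rw [infConv.eq_def (fun y => f (Fin.cons t y)), Real.mul_iInf_of_nonneg hθ.1]
    exact le_ciInf fun z => by linarith [h2 z]
  linarith

theorem toReal_cons {m : ℕ} (b : Bool) (a : Fin m → Bool) :
    toReal (Fin.cons b a : Fin (m + 1) → Bool) =
      (Fin.cons (if b then 1 else 0) (toReal a) : Fin (m + 1) → ℝ) := by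
  funext i
  refine Fin.cases ?_ (fun i => ?_) i <;> simp [toReal]

/-- Maurey's convex infimum convolution inequality on the discrete cube. -/
theorem expect_exp_infConv_fin {m : ℕ} {p : Fin m → ℝ} (hp : ∀ i, p i ∈ Set.Icc (0 : ℝ) 1)
    {f : (Fin m → ℝ) → ℝ} (hc : ConvexOn ℝ Set.univ f) (hf : ∀ x, 0 ≤ f x) :
    expect p (fun a => Real.exp (infConv f (toReal a))) *
      expect p (fun a => Real.exp (-f (toReal a))) ≤ 1 := by
  induction m with
  | zero =>
    have h : ∀ x, infConv f x ≤ f x := fun x => by simpa using infConv_le hf x x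
    simp only [expect, weight, Finset.univ_unique, Finset.sum_singleton, Finset.univ_eq_empty,
      Finset.prod_empty, one_mul]
    rw [← Real.exp_add, Real.exp_le_one_iff, ← sub_eq_add_neg, sub_nonpos]
    exact h _
  | succ m ih =>
    set p' : Fin m → ℝ := fun i => p i.succ
    have hp' : ∀ i, p' i ∈ Set.Icc (0 : ℝ) 1 := fun i => hp _
    have hcs : ∀ s : ℝ, ConvexOn ℝ Set.univ fun y : Fin m → ℝ => f (Fin.cons s y) := by
      intro s
      refine ⟨convex_univ, fun x _ y _ α β hα hβ hαβ => ?_⟩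
      have := hc.2 (Set.mem_univ (Fin.cons s x)) (Set.mem_univ (Fin.cons s y)) hα hβ hαβ
      convert this using 2
      funext i
      refine Fin.cases ?_ (fun i => ?_) i
      · simp [← add_mul, hαβ]
      · simp
    set E : ℝ → ℝ := fun s => expect p' fun a => Real.exp (-f (Fin.cons s (toReal a)))
    set q : ℝ → ℝ := fun s =>
      expect p' fun a => Real.exp (infConv (fun y => f (Fin.cons s y)) (toReal a))
    have hE : ∀ s, 0 < E s := by
      intro s
      have hne : 0 ≤ E s := by
        have := expect_mono hp' (φ := fun _ => 0)
          (ψ := fun a => Real.exp (-f (Fin.cons s (toReal a)))) fun a => (Real.exp_pos _).le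
        rwa [expect_const] at this
      refine lt_of_le_of_ne hne fun h => ?_
      have hz := (Finset.sum_eq_zero_iff_of_nonneg fun a _ =>
        mul_nonneg (weight_nonneg hp' a) (Real.exp_pos _).le).1 h.symm
      have : ∑ a, weight p' a = 0 := Finset.sum_eq_zero fun a ha =>
        (mul_eq_zero.1 (hz a ha)).resolve_right (Real.exp_pos _).ne'
      rw [sum_weight] at this
      exact one_ne_zero this
    have hq : ∀ s, q s * E s ≤ 1 := fun s => ih hp' (hcs s) fun x => hf _
    -- The hypothesis of `two_point` with u = log E. The two slices are normalized by E so that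
    -- convexity of exp replaces Hölder's inequality, and the induction hypothesis bounds each
    -- normalized mean by 1.
    have bound : ∀ s t : ℝ, (s - t) ^ 2 ≤ 1 → ∀ θ ∈ Set.Icc (0 : ℝ) 1,
        expect p' (fun a => Real.exp (infConv f (Fin.cons s (toReal a)))) ≤
          Real.exp (θ ^ 2 / 8 - (1 - θ) * Real.log (E s) - θ * Real.log (E t)) := by
      intro s t hst θ hθ
      have h1 : 0 ≤ 1 - θ := by linarith [hθ.2]
      set c := Real.exp (θ ^ 2 / 8 - (1 - θ) * Real.log (E s) - θ * Real.log (E t))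
      have hc0 : 0 ≤ c := (Real.exp_pos _).le
      calc _ ≤ expect p' (fun a => c * ((1 - θ) * (E s *
              Real.exp (infConv (fun y => f (Fin.cons s y)) (toReal a))) +
              θ * (E t * Real.exp (infConv (fun y => f (Fin.cons t y)) (toReal a))))) := by
            refine expect_mono hp' fun a => ?_
            set u := infConv (fun y => f (Fin.cons s y)) (toReal a)
            set v := infConv (fun y => f (Fin.cons t y)) (toReal a)
            have hle := infConv_cons_le hc hf hθ s t hst (toReal a)
            have hexp := convexOn_exp.2 (Set.mem_univ (Real.log (E s) + u))
              (Set.mem_univ (Real.log (E t) + v)) h1 hθ.1 (by ring)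
            simp only [smul_eq_mul, Real.exp_add, Real.exp_log (hE _)] at hexp
            refine le_trans ?_ (mul_le_mul_of_nonneg_left hexp hc0)
            rw [← Real.exp_add, ← Real.exp_add]
            exact Real.exp_le_exp.2 (by linarith)
        _ = c * ((1 - θ) * (q s * E s) + θ * (q t * E t)) := by
            simp only [expect_const_mul, expect_add]
            ring
        _ ≤ c * ((1 - θ) * 1 + θ * 1) := by
            refine mul_le_mul_of_nonneg_left ?_ hc0
            exact add_le_add (mul_le_mul_of_nonneg_left (hq s) h1)
              (mul_le_mul_of_nonneg_left (hq t) hθ.1)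
        _ = c := by ring
    have := two_point (hp 0) (bound 1 0 (by norm_num)) (bound 0 1 (by norm_num))
    rw [Real.exp_log (hE _), Real.exp_log (hE _)] at this
    rw [expect_cons, expect_cons]
    simpa only [toReal_cons, if_true, Bool.false_eq_true, if_false] using this

variable {I : Type*} [Fintype I] [DecidableEq I]

theorem expect_exp_infConv {p : I → ℝ} (hp : ∀ i, p i ∈ Set.Icc (0 : ℝ) 1)
    {f : (I → ℝ) → ℝ} (hc : ConvexOn ℝ Set.univ f) (hf : ∀ x, 0 ≤ f x) :
    expect p (fun a => Real.exp (infConv f (toReal a))) *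
      expect p (fun a => Real.exp (-f (toReal a))) ≤ 1 := by
  set e := (Fintype.equivFin I).symm
  have hc' : ConvexOn ℝ Set.univ fun y : Fin (Fintype.card I) → ℝ => f fun i => y (e.symm i) :=
    ⟨convex_univ, fun x _ y _ α β hα hβ hαβ => hc.2 (Set.mem_univ fun i => x (e.symm i))
      (Set.mem_univ fun i => y (e.symm i)) hα hβ hαβ⟩
  have h := expect_exp_infConv_fin (p := fun j => p (e j)) (fun j => hp _) hc' fun x => hf _
  rw [expect_equiv e, expect_equiv e p fun a => Real.exp (-f (toReal a))]
  refine le_trans (le_of_eq ?_) h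
  congr 2
  funext b
  congr 1
  rw [infConv, infConv, ← (e.arrowCongr (Equiv.refl ℝ)).iInf_comp]
  refine iInf_congr fun y => ?_
  rw [← e.sum_comp]
  simp [toReal, Equiv.arrowCongr, Function.comp_def]

/-! ### Concentration of convex Lipschitz functions -/

/-- The probability of a set of vertices of the cube. -/
noncomputable def prob (p : I → ℝ) (s : Set (I → Bool)) : ℝ := expect p (s.indicator fun _ => 1)

theorem prob_mono {p : I → ℝ} (hp : ∀ i, p i ∈ Set.Icc (0 : ℝ) 1) {s t : Set (I → Bool)}
    (h : s ⊆ t) : prob p s ≤ prob p t :=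
  expect_mono hp fun a => Set.indicator_le_indicator_of_subset h (fun _ => zero_le_one) a

theorem prob_compl (p : I → ℝ) (s : Set (I → Bool)) : prob p sᶜ = 1 - prob p s := by
  have h := expect_add p (s.indicator fun _ => 1) (sᶜ.indicator fun _ => 1)
  have e : (fun a => s.indicator (fun _ => (1 : ℝ)) a + sᶜ.indicator (fun _ => 1) a) =
      fun _ => 1 := by
    funext a
    exact congrFun (Set.indicator_self_add_compl s fun _ => (1 : ℝ)) a
  rw [e, expect_const] at h
  simp only [prob]
  linarith

/-- Markov's inequality. -/
theorem mul_prob_le_expect {p : I → ℝ} (hp : ∀ i, p i ∈ Set.Icc (0 : ℝ) 1) {φ : (I → Bool) → ℝ}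
    (hφ : ∀ a, 0 ≤ φ a) (c : ℝ) : c * prob p {a | c ≤ φ a} ≤ expect p φ := by
  rw [prob, ← expect_const_mul]
  refine expect_mono hp fun a => ?_
  by_cases h : a ∈ {a | c ≤ φ a}
  · rw [Set.indicator_of_mem h]
    simpa using h
  · rw [Set.indicator_of_notMem h]
    simpa using hφ a

/-- Talagrand's concentration inequality for convex functions on the discrete cube. -/
theorem prob_mul_prob_le {p : I → ℝ} (hp : ∀ i, p i ∈ Set.Icc (0 : ℝ) 1)
    {Z : (I → ℝ) → ℝ} (hc : ConvexOn ℝ Set.univ Z)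
    (hZ : ∀ x y, Z x - Z y ≤ √(∑ i, (x i - y i) ^ 2)) (M : ℝ) {t : ℝ} (ht : 0 ≤ t) :
    prob p {a | M + t ≤ Z (toReal a)} * prob p {a | Z (toReal a) ≤ M} ≤
      Real.exp (-(t ^ 2 / 16)) := by
  set s : (I → ℝ) → ℝ := fun x => max (Z x - M) 0
  have hs0 : ∀ x, 0 ≤ s x := fun x => le_max_right _ _
  have hsc : ConvexOn ℝ Set.univ s :=
    (hc.sub (concaveOn_const M convex_univ)).sup (convexOn_const 0 convex_univ)
  -- This f vanishes where Z ≤ M. Where Z ≥ M + t its infimum convolution is at least t²/16, because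
  -- s² + D ≥ (s + √D)²/2 and s + √D ≥ t.
  set f : (I → ℝ) → ℝ := fun x => s x ^ 2 / 8
  have hf0 : ∀ x, 0 ≤ f x := fun x => by positivity
  have hfc : ConvexOn ℝ Set.univ f := by
    have := (hsc.pow (fun x _ => hs0 x) 2).smul (c := (1 / 8 : ℝ)) (by norm_num)
    refine this.congr fun x _ => ?_
    simp [f, smul_eq_mul]
    ring
  have hmain := expect_exp_infConv hp hfc hf0
  have hinf : ∀ x, M + t ≤ Z x → t ^ 2 / 16 ≤ infConv f x := by
    intro x hx
    refine le_ciInf fun y => ?_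
    have h1 := hZ x y
    set D := ∑ i, (x i - y i) ^ 2
    have hD : 0 ≤ D := Finset.sum_nonneg fun i _ => sq_nonneg _
    have h2 : Z y - M ≤ s y := le_max_left _ _
    have h3 := Real.sq_sqrt hD
    have h4 := Real.sqrt_nonneg D
    have h5 : t ≤ s y + √D := by linarith
    have h6 : t ^ 2 ≤ (s y + √D) ^ 2 := pow_le_pow_left₀ ht h5 2
    simp only [f]
    nlinarith [sq_nonneg (s y - √D)]
  have h1 : Real.exp (t ^ 2 / 16) * prob p {a | M + t ≤ Z (toReal a)} ≤
      expect p fun a => Real.exp (infConv f (toReal a)) := by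
    refine le_trans ?_ (mul_prob_le_expect hp (fun a => (Real.exp_pos _).le)
      (Real.exp (t ^ 2 / 16)))
    refine mul_le_mul_of_nonneg_left (prob_mono hp fun a ha => ?_) (Real.exp_pos _).le
    exact Real.exp_le_exp.2 (hinf _ ha)
  have h2 : prob p {a | Z (toReal a) ≤ M} ≤ expect p fun a => Real.exp (-f (toReal a)) := by
    refine expect_mono hp fun a => ?_
    by_cases h : a ∈ {a | Z (toReal a) ≤ M}
    · rw [Set.indicator_of_mem h]
      have h' : Z (toReal a) ≤ M := h
      have : s (toReal a) = 0 := max_eq_right (by linarith)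
      simp [f, this]
    · rw [Set.indicator_of_notMem h]
      exact (Real.exp_pos _).le
  have hnn : ∀ s, 0 ≤ prob p s := fun s => by
    have := prob_mono hp (Set.empty_subset s)
    simpa [prob, expect] using this
  have h3 : Real.exp (t ^ 2 / 16) * (prob p {a | M + t ≤ Z (toReal a)} *
      prob p {a | Z (toReal a) ≤ M}) ≤ 1 := by
    rw [← mul_assoc]
    exact (mul_le_mul h1 h2 (hnn _) ((mul_nonneg (Real.exp_pos _).le (hnn _)).trans h1)).trans hmain
  rw [Real.exp_neg, ← one_div, le_div_iff₀ (Real.exp_pos _)]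
  linarith

/-! ### Trace inequalities for symmetric matrices -/

section Trace

open Matrix

variable {v : Type*} [Fintype v] [DecidableEq v]

theorem exists_pow_eq_conj_diagonal {X : Matrix v v ℝ} (hX : X.IsHermitian) :
    ∃ U ∈ Matrix.unitaryGroup v ℝ, ∃ d : v → ℝ,
      ∀ k : ℕ, X ^ k = U * diagonal (fun i => d i ^ k) * Uᵀ := by
  refine ⟨hX.eigenvectorUnitary, hX.eigenvectorUnitary.2, hX.eigenvalues, fun k => ?_⟩
  have h := hX.spectral_theorem
  conv_lhs => rw [h, ← map_pow, diagonal_pow, Unitary.conjStarAlgAut_apply]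
  rw [star_eq_conjTranspose, conjTranspose_eq_transpose_of_trivial]
  rfl

/-- Diagonalizing X and Y by U and V, the coefficients are the squares of the entries of UᵀEV. Their
sign reduces such trace inequalities to scalar ones for pairs of eigenvalues. -/
theorem trace_mul_pow_mul_pow_eq_sum {X Y E : Matrix v v ℝ} (hX : X.IsHermitian)
    (hY : Y.IsHermitian) (hE : E.IsHermitian) : ∃ (c : v → v → ℝ) (d f : v → ℝ), (∀ i j, 0 ≤ c i j) ∧
      ∀ q s : ℕ, trace (E * X ^ q * E * Y ^ s) = ∑ i, ∑ j, c i j * (d i ^ q * f j ^ s) := by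
  obtain ⟨U, -, d, hd⟩ := exists_pow_eq_conj_diagonal hX
  obtain ⟨V, -, f, hf⟩ := exists_pow_eq_conj_diagonal hY
  have hE' : Eᵀ = E := by rwa [IsHermitian, conjTranspose_eq_transpose_of_trivial] at hE
  refine ⟨fun i j => (Uᵀ * E * V) i j ^ 2, d, f, fun i j => sq_nonneg _, fun q s => ?_⟩
  rw [hd, hf]
  calc _ = trace ((diagonal fun i => d i ^ q) * (Uᵀ * E * V) * (diagonal fun j => f j ^ s) *
        (Uᵀ * E * V)ᵀ) := by
        rw [transpose_mul, transpose_mul, transpose_transpose, hE']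
        rw [show E * (U * (diagonal fun i => d i ^ q) * Uᵀ) * E *
          (V * (diagonal fun j => f j ^ s) * Vᵀ) = (E * U) * ((diagonal fun i => d i ^ q) *
          (Uᵀ * E * V) * (diagonal fun j => f j ^ s) * Vᵀ) by simp only [Matrix.mul_assoc],
          trace_mul_comm]
        simp only [Matrix.mul_assoc]
    _ = _ := by
        rw [trace]
        refine Finset.sum_congr rfl fun i _ => ?_
        rw [diag_apply, Matrix.mul_apply]
        refine Finset.sum_congr rfl fun j _ => ?_
        rw [mul_diagonal, diagonal_mul, transpose_apply]
        ring

theorem pow_mul_pow_le_add (x y : ℝ) {q s r : ℕ} (h : q + s = 2 * r) :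
    x ^ q * y ^ s ≤ x ^ (2 * r) + y ^ (2 * r) := by
  have hx : x ^ (2 * r) = |x| ^ (2 * r) := by rw [pow_mul, pow_mul, sq_abs]
  have hy : y ^ (2 * r) = |y| ^ (2 * r) := by rw [pow_mul, pow_mul, sq_abs]
  have h0 : x ^ q * y ^ s ≤ |x| ^ q * |y| ^ s := by
    rw [← abs_pow, ← abs_pow, ← abs_mul]
    exact le_abs_self _
  refine h0.trans ?_
  rw [hx, hy]
  rcases le_total |x| |y| with hxy | hxy
  · calc |x| ^ q * |y| ^ s ≤ |y| ^ q * |y| ^ s := by gcongr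
      _ = |y| ^ (2 * r) := by rw [← pow_add, h]
      _ ≤ _ := le_add_of_nonneg_left (by positivity)
  · calc |x| ^ q * |y| ^ s ≤ |x| ^ q * |x| ^ s := by gcongr
      _ = |x| ^ (2 * r) := by rw [← pow_add, h]
      _ ≤ _ := le_add_of_nonneg_right (by positivity)

theorem trace_mul_pow_mul_pow_le {X Y E : Matrix v v ℝ} (hX : X.IsHermitian)
    (hY : Y.IsHermitian) (hE : E.IsHermitian) {q s r : ℕ} (h : q + s = 2 * r) :
    trace (E * X ^ q * E * Y ^ s) ≤
      trace (E * E * X ^ (2 * r)) + trace (E * E * Y ^ (2 * r)) := by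
  obtain ⟨c, d, f, hc, hcdf⟩ := trace_mul_pow_mul_pow_eq_sum hX hY hE
  have h1 := hcdf (2 * r) 0
  have h2 := hcdf 0 (2 * r)
  rw [pow_zero, Matrix.mul_one, trace_mul_comm, ← Matrix.mul_assoc] at h1
  rw [pow_zero, Matrix.mul_one] at h2
  rw [hcdf, h1, h2, ← Finset.sum_add_distrib]
  refine Finset.sum_le_sum fun i _ => ?_
  rw [← Finset.sum_add_distrib]
  refine Finset.sum_le_sum fun j _ => ?_
  rw [← mul_add]
  refine mul_le_mul_of_nonneg_left ?_ (hc i j)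
  simpa using pow_mul_pow_le_add (d i) (f j) h

theorem pow_sub_pow_eq_sum (X Y : Matrix v v ℝ) (m : ℕ) :
    X ^ m - Y ^ m = ∑ q ∈ Finset.range m, X ^ q * (X - Y) * Y ^ (m - 1 - q) := by
  induction m with
  | zero => simp
  | succ m ih =>
    rw [Finset.sum_range_succ, Nat.add_sub_cancel, Nat.sub_self, pow_zero, Matrix.mul_one]
    have : ∑ q ∈ Finset.range m, X ^ q * (X - Y) * Y ^ (m - q) = (X ^ m - Y ^ m) * Y := by
      rw [ih, Finset.sum_mul]
      refine Finset.sum_congr rfl fun q hq => ?_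
      have := Finset.mem_range.1 hq
      rw [Matrix.mul_assoc _ _ Y, ← pow_succ, show m - 1 - q + 1 = m - q by omega]
    rw [this, pow_succ, pow_succ]
    noncomm_ring

/-- Each of the 2r + 1 terms of the telescoping sum is a mixed trace with total degree 2r in X and
Y. -/
theorem trace_mul_pow_sub_pow_le {X Y E : Matrix v v ℝ} (hX : X.IsHermitian)
    (hY : Y.IsHermitian) (hE : X - Y = E) (r : ℕ) :
    trace (E * (X ^ (2 * r + 1) - Y ^ (2 * r + 1))) ≤ (2 * r + 1) *
      (trace (E * E * X ^ (2 * r)) + trace (E * E * Y ^ (2 * r))) := by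
  have hE' : E.IsHermitian := hE ▸ hX.sub hY
  rw [pow_sub_pow_eq_sum, hE, Finset.mul_sum, trace_sum]
  refine (Finset.sum_le_card_nsmul _ _
    (trace (E * E * X ^ (2 * r)) + trace (E * E * Y ^ (2 * r))) fun q hq => ?_).trans ?_
  · have := Finset.mem_range.1 hq
    rw [← Matrix.mul_assoc, ← Matrix.mul_assoc]
    exact trace_mul_pow_mul_pow_le hX hY hE' (by omega)
  · rw [Finset.card_range, nsmul_eq_mul]
    push_cast
    exact le_rfl

theorem mul_pow_le_half_pow_add {c x : ℝ} (hc : 0 ≤ c) (r : ℕ) :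
    c * x ^ (2 * r) ≤ x ^ (2 * (r + 1)) / 2 + (2 * c) ^ (r + 1) := by
  rw [pow_mul, pow_mul]
  have hx := sq_nonneg x
  set y := x ^ 2
  rcases le_total (2 * c) y with h | h
  · have : c * y ^ r ≤ y / 2 * y ^ r := by gcongr; linarith
    have h2 : y / 2 * y ^ r = y ^ (r + 1) / 2 := by ring
    have h3 : 0 ≤ (2 * c) ^ (r + 1) := by positivity
    linarith
  · have : c * y ^ r ≤ (2 * c) * (2 * c) ^ r := by gcongr; linarith
    have h2 : (2 * c) * (2 * c) ^ r = (2 * c) ^ (r + 1) := by ring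
    have h3 : 0 ≤ y ^ (r + 1) / 2 := by positivity
    linarith

/-- The numbers (X^k) i i are the moments of a probability measure on the spectrum, so the scalar
Young-type inequality can be averaged. The factor 1/2 allows absorption in the trace recursion. -/
theorem mul_pow_apply_self_le {X : Matrix v v ℝ} (hX : X.IsHermitian) {c : ℝ} (hc : 0 ≤ c)
    (r : ℕ) (i : v) :
    c * (X ^ (2 * r)) i i ≤ (X ^ (2 * (r + 1))) i i / 2 + (2 * c) ^ (r + 1) := by
  obtain ⟨U, hU, d, hd⟩ := exists_pow_eq_conj_diagonal hX
  have hdiag : ∀ k, (X ^ k) i i = ∑ j, U i j ^ 2 * d j ^ k := by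
    intro k
    rw [hd, Matrix.mul_apply]
    refine Finset.sum_congr rfl fun j _ => ?_
    rw [mul_diagonal, transpose_apply]
    ring
  have hone : ∑ j, U i j ^ 2 = 1 := by
    have := hdiag 0
    simpa using this.symm
  rw [hdiag, hdiag, Finset.mul_sum, Finset.sum_div]
  calc _ ≤ ∑ j, (U i j ^ 2 * d j ^ (2 * (r + 1)) / 2 + U i j ^ 2 * (2 * c) ^ (r + 1)) := by
        refine Finset.sum_le_sum fun j _ => ?_
        have := mul_le_mul_of_nonneg_left (mul_pow_le_half_pow_add (x := d j) hc r)
          (sq_nonneg (U i j))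
        linarith
    _ = _ := by rw [Finset.sum_add_distrib, ← Finset.sum_mul, hone, one_mul]

theorem pow_two_mul_apply_self_nonneg {X : Matrix v v ℝ} (hX : X.IsHermitian) (r : ℕ) (i : v) :
    0 ≤ (X ^ (2 * r)) i i := by
  obtain ⟨U, hU, d, hd⟩ := exists_pow_eq_conj_diagonal hX
  rw [hd, Matrix.mul_apply]
  refine Finset.sum_nonneg fun j _ => ?_
  rw [mul_diagonal, transpose_apply]
  have : 0 ≤ U i j ^ 2 * (d j ^ r) ^ 2 := by positivity
  calc _ ≤ U i j ^ 2 * (d j ^ r) ^ 2 := this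
    _ = _ := by ring

open scoped Matrix.Norms.L2Operator in
theorem norm_pow_two_mul_le_trace {X : Matrix v v ℝ} (hX : X.IsHermitian) (q : ℕ) (hq : q ≠ 0) :
    ‖X‖ ^ (2 * q) ≤ trace (X ^ (2 * q)) := by
  obtain ⟨U, hU, d, hd⟩ := exists_pow_eq_conj_diagonal hX
  have htr : trace (X ^ (2 * q)) = ∑ i, d i ^ (2 * q) := by
    have hU' : Uᵀ * U = 1 := by
      have := (Matrix.mem_unitaryGroup_iff').1 hU
      rwa [star_eq_conjTranspose, conjTranspose_eq_transpose_of_trivial] at this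
    rw [hd, trace_mul_comm, ← Matrix.mul_assoc, hU', Matrix.one_mul, trace_diagonal]
  have hnorm : ‖X‖ = ‖d‖ := by
    have h1 := hd 1
    simp only [pow_one] at h1
    rw [h1, Matrix.mul_assoc, CStarRing.norm_coe_unitary_mul ⟨U, hU⟩]
    have hU' : Uᵀ ∈ Matrix.unitaryGroup v ℝ := by
      have := Unitary.star_mem hU
      rwa [star_eq_conjTranspose, conjTranspose_eq_transpose_of_trivial] at this
    rw [CStarRing.norm_mul_coe_unitary _ ⟨Uᵀ, hU'⟩, l2_opNorm_diagonal]
  rw [htr, hnorm]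
  rcases isEmpty_or_nonempty v with hv | hv
  · rw [Subsingleton.elim d 0, norm_zero]
    simp [hq]
  · obtain ⟨i, hi⟩ := Finite.exists_max fun i => ‖d i‖
    have h1 : ‖d‖ ≤ ‖d i‖ := (pi_norm_le_iff_of_nonneg (norm_nonneg _)).2 hi
    have h2 : ∀ j, 0 ≤ d j ^ (2 * q) := fun j => by rw [pow_mul]; positivity
    calc ‖d‖ ^ (2 * q) ≤ ‖d i‖ ^ (2 * q) := by gcongr
      _ = d i ^ (2 * q) := by rw [pow_mul, pow_mul, Real.norm_eq_abs, sq_abs]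
      _ ≤ _ := Finset.single_le_sum (fun j _ => h2 j) (Finset.mem_univ i)

end Trace

/-! ### Symmetric dilation of rectangular matrices -/

section Dilation

open Matrix

variable {ι κ : Type*}

/-- The symmetric dilation of a rectangular matrix. -/
def dilation (H : Matrix ι κ ℝ) : Matrix (ι ⊕ κ) (ι ⊕ κ) ℝ := fromBlocks 0 H Hᵀ 0

theorem isHermitian_dilation (H : Matrix ι κ ℝ) : (dilation H).IsHermitian := by
  refine IsHermitian.fromBlocks isHermitian_zero ?_ isHermitian_zero
  rw [conjTranspose_eq_transpose_of_trivial]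

theorem dilation_sub (H G : Matrix ι κ ℝ) : dilation (H - G) = dilation H - dilation G := by
  simp [dilation, sub_eq_add_neg, fromBlocks_neg, fromBlocks_add]

variable [Fintype ι] [Fintype κ] [DecidableEq ι] [DecidableEq κ]

-- On vectors (0, x) the dilation acts as H.
open scoped Matrix.Norms.L2Operator in
theorem specNorm_le_norm_dilation (H : Matrix ι κ ℝ) : DMPRDPG.specNorm H ≤ ‖dilation H‖ := by
  refine ContinuousLinearMap.opNorm_le_bound _ (norm_nonneg _) fun x => ?_
  have h := l2_opNorm_mulVec (dilation H) (WithLp.toLp 2 (Sum.elim 0 x.ofLp))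
  have h1 : ‖(WithLp.toLp 2 (Sum.elim (0 : ι → ℝ) x.ofLp) : EuclideanSpace ℝ (ι ⊕ κ))‖ = ‖x‖ := by
    rw [EuclideanSpace.norm_eq, EuclideanSpace.norm_eq]
    simp
  rw [h1] at h
  refine le_trans (le_of_eq ?_) h
  rw [EuclideanSpace.norm_eq, EuclideanSpace.norm_eq]
  simp [dilation, fromBlocks_mulVec, toLpLin_apply]

theorem specNorm_pow_le_trace (H : Matrix ι κ ℝ) (q : ℕ) (hq : q ≠ 0) :
    DMPRDPG.specNorm H ^ (2 * q) ≤ trace (dilation H ^ (2 * q)) :=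
  (pow_le_pow_left₀ (norm_nonneg _) (specNorm_le_norm_dilation H) _).trans
    (norm_pow_two_mul_le_trace (isHermitian_dilation H) q hq)

theorem dilation_single_mul_self (i : ι) (j : κ) :
    dilation (single i j 1) * dilation (single i j (1 : ℝ)) =
      fromBlocks (single i i 1) 0 0 (single j j 1) := by
  simp [dilation, fromBlocks_multiply]

theorem trace_dilation_single_sq_mul (i : ι) (j : κ) (M : Matrix (ι ⊕ κ) (ι ⊕ κ) ℝ) :
    trace (dilation (single i j 1) * dilation (single i j (1 : ℝ)) * M) =
      M (Sum.inl i) (Sum.inl i) + M (Sum.inr j) (Sum.inr j) := by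
  rw [dilation_single_mul_self, ← fromBlocks_toBlocks M, fromBlocks_multiply]
  simp only [trace, Fintype.sum_sum_type, diag_apply, fromBlocks_apply₁₁, fromBlocks_apply₂₂,
    Matrix.zero_mul, add_zero, zero_add]
  rw [Fintype.sum_eq_single i, Fintype.sum_eq_single j]
  · simp
  · intro k hk
    simp [hk]
  · intro k hk
    simp [hk]

theorem dilation_eq_sum (H : Matrix ι κ ℝ) :
    dilation H = ∑ k : ι × κ, H k.1 k.2 • dilation (single k.1 k.2 1) := by
  ext a b
  rw [Matrix.sum_apply, Fintype.sum_prod_type]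
  rcases a with a | a <;> rcases b with b | b <;> simp [dilation, single_apply, ite_and]

end Dilation

/-! ### Moments of Bernoulli sums -/

section Moment

variable {I : Type*} [Fintype I] [DecidableEq I]

theorem expect_pow_sum_le {p : I → ℝ} (hp : ∀ i, p i ∈ Set.Icc (0 : ℝ) 1) (s : Finset I) {R : ℝ}
    (hR : ∑ i ∈ s, p i ≤ R) (hR0 : 0 < R) {q : ℕ} (hq : q ≤ R) :
    expect p (fun a => (∑ i ∈ s, (toReal a i + p i)) ^ q) ≤ (Real.exp 3 * R) ^ q := by
  -- From y ≤ exp y at y = r/R comes r^q ≤ R^q exp(θr). As θ ≤ 1, each factor has mean at most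
  -- exp(3θp), and 3θR = 3q yields the constant e³.
  set θ := (q : ℝ) / R
  have hθ0 : 0 ≤ θ := by positivity
  have hθ1 : θ ≤ 1 := (div_le_one hR0).2 hq
  have hθR : θ * R = q := div_mul_cancel₀ _ hR0.ne'
  have hexp : Real.exp θ ≤ 1 + 2 * θ := by
    have := (abs_le.1 (Real.abs_exp_sub_one_sub_id_le (x := θ) (abs_le.2 ⟨by linarith, hθ1⟩))).2
    nlinarith
  set g : I → Bool → ℝ := fun i b =>
    if i ∈ s then Real.exp (θ * ((if b then 1 else 0) + p i)) else 1
  have hpt : ∀ a : I → Bool, (∑ i ∈ s, (toReal a i + p i)) ^ q ≤ R ^ q * ∏ i, g i (a i) := by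
    intro a
    set r := ∑ i ∈ s, (toReal a i + p i)
    have hr : 0 ≤ r := Finset.sum_nonneg fun i _ => by
      have := (hp i).1
      unfold toReal
      split_ifs <;> linarith
    have hprod : ∏ i, g i (a i) = Real.exp (θ * r) := by
      simp only [g, Finset.prod_ite_mem, Finset.univ_inter, r, Finset.mul_sum, Real.exp_sum]
      rfl
    have h1 : r / R ≤ Real.exp (r / R) := by linarith [Real.add_one_le_exp (r / R)]
    have h2 : (r / R) ^ q ≤ Real.exp (r / R) ^ q := pow_le_pow_left₀ (by positivity) h1 q
    rw [hprod]
    calc r ^ q = R ^ q * (r / R) ^ q := by rw [← mul_pow, mul_div_cancel₀ _ hR0.ne']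
      _ ≤ R ^ q * Real.exp (r / R) ^ q := by gcongr
      _ = R ^ q * Real.exp (θ * r) := by
        rw [← Real.exp_nat_mul]
        congr 2
        simp only [θ]
        ring
  calc _ ≤ expect p (fun a => R ^ q * ∏ i, g i (a i)) := expect_mono hp hpt
    _ = R ^ q * ∏ i, (p i * g i true + (1 - p i) * g i false) := by
        rw [expect_const_mul, expect_prod]
    _ ≤ R ^ q * ∏ i, (if i ∈ s then Real.exp (3 * θ * p i) else 1) := by
        refine mul_le_mul_of_nonneg_left ?_ (by positivity)
        refine Finset.prod_le_prod (fun i _ => ?_) fun i _ => ?_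
        · have h1 := (hp i).1
          have h2 : 0 ≤ 1 - p i := by linarith [(hp i).2]
          have h3 : ∀ b, 0 ≤ g i b := fun b => by
            simp only [g]
            split_ifs <;> positivity
          have := h3 true
          have := h3 false
          positivity
        · by_cases hi : i ∈ s
          · simp only [g, hi, if_true, Bool.false_eq_true, if_false]
            have h1 : p i * Real.exp θ + (1 - p i) ≤ Real.exp (2 * θ * p i) := by
              have := Real.add_one_le_exp (2 * θ * p i)
              nlinarith [(hp i).1]
            calc _ = Real.exp (θ * p i) * (p i * Real.exp θ + (1 - p i)) := by
                  rw [mul_add, zero_add, mul_one, Real.exp_add]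
                  ring
              _ ≤ Real.exp (θ * p i) * Real.exp (2 * θ * p i) := by gcongr
              _ = Real.exp (3 * θ * p i) := by rw [← Real.exp_add]; ring_nf
          · simp [g, hi]
    _ = R ^ q * Real.exp (3 * θ * ∑ i ∈ s, p i) := by
        rw [Finset.prod_ite_mem, Finset.univ_inter, ← Real.exp_sum, Finset.mul_sum]
    _ ≤ R ^ q * Real.exp (3 * θ * R) := by gcongr
    _ = _ := by
        rw [mul_pow, ← Real.exp_nat_mul, ← hθR]
        ring_nf

end Moment

/-! ### Elementary properties of the spectral norm -/

section SpecNorm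

variable {ι κ : Type*} [Fintype ι] [Fintype κ] [DecidableEq κ]

theorem specNorm_nonneg (A : Matrix ι κ ℝ) : 0 ≤ DMPRDPG.specNorm A := norm_nonneg _

theorem specNorm_add_le (A B : Matrix ι κ ℝ) :
    DMPRDPG.specNorm (A + B) ≤ DMPRDPG.specNorm A + DMPRDPG.specNorm B := by
  simp only [DMPRDPG.specNorm, map_add]
  exact norm_add_le _ _

theorem specNorm_smul (c : ℝ) (A : Matrix ι κ ℝ) :
    DMPRDPG.specNorm (c • A) = |c| * DMPRDPG.specNorm A := by
  simp only [DMPRDPG.specNorm, map_smul]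
  rw [norm_smul, Real.norm_eq_abs]

theorem specNorm_le_sqrt_sum_sq (A : Matrix ι κ ℝ) :
    DMPRDPG.specNorm A ≤ √(∑ k : ι × κ, A k.1 k.2 ^ 2) := by
  refine ContinuousLinearMap.opNorm_le_bound _ (Real.sqrt_nonneg _) fun x => ?_
  rw [EuclideanSpace.norm_eq, EuclideanSpace.norm_eq, ← Real.sqrt_mul
    (Finset.sum_nonneg fun _ _ => sq_nonneg _)]
  refine Real.sqrt_le_sqrt ?_
  rw [Fintype.sum_prod_type, Finset.sum_mul]
  refine Finset.sum_le_sum fun i _ => ?_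
  simp only [Real.norm_eq_abs, sq_abs]
  exact Finset.sum_mul_sq_le_sq_mul_sq _ _ _

end SpecNorm

/-! ### Norm of a centered Bernoulli matrix -/

section Noise

open Matrix

variable {ι κ : Type*}

/-- The matrix with the entries of `x - p`. -/
def centered (p x : ι × κ → ℝ) : Matrix ι κ ℝ := Matrix.of fun i j => x (i, j) - p (i, j)

section

variable [Fintype ι] [Fintype κ] [DecidableEq κ]

theorem convexOn_specNorm_centered (p : ι × κ → ℝ) :
    ConvexOn ℝ Set.univ fun x => DMPRDPG.specNorm (centered p x) := by
  refine ⟨convex_univ, fun x _ y _ α β hα hβ hαβ => ?_⟩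
  have h : centered p (α • x + β • y) = α • centered p x + β • centered p y := by
    ext i j
    simp only [centered, of_apply, Matrix.add_apply, Matrix.smul_apply, Pi.add_apply, Pi.smul_apply,
      smul_eq_mul]
    linear_combination p (i, j) * hαβ
  simp only [h, smul_eq_mul]
  refine (specNorm_add_le _ _).trans ?_
  rw [specNorm_smul, specNorm_smul, abs_of_nonneg hα, abs_of_nonneg hβ]

theorem specNorm_centered_sub_le (p x y : ι × κ → ℝ) :
    DMPRDPG.specNorm (centered p x) - DMPRDPG.specNorm (centered p y) ≤
      √(∑ k, (x k - y k) ^ 2) := by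
  have h : centered p x = (centered y x) + centered p y := by
    ext i j
    simp [centered]
  have h1 := specNorm_add_le (centered y x) (centered p y)
  rw [← h] at h1
  have h2 := specNorm_le_sqrt_sum_sq (centered y x)
  simp only [centered, of_apply, Prod.mk.eta] at h1 h2 ⊢
  linarith

end

variable [DecidableEq ι] [DecidableEq κ]

theorem centered_update_sub (p : ι × κ → ℝ) (a : ι × κ → Bool) (k : ι × κ) :
    centered p (toReal (Function.update a k true)) -
      centered p (toReal (Function.update a k false)) = single k.1 k.2 1 := by
  ext i j
  by_cases h : k = (i, j)
  · subst h
    simp [centered, toReal]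
  · have h' : ¬ (k.1 = i ∧ k.2 = j) := fun h' => h (Prod.ext h'.1 h'.2)
    simp [centered, toReal, Function.update_of_ne (Ne.symm h), h']

variable [Fintype ι] [Fintype κ]

/-- The recursive trace moment estimate, obtained by exchanging single entries. -/
theorem expect_trace_dilation_pow_le {p : ι × κ → ℝ} (hp : ∀ k, p k ∈ Set.Icc (0 : ℝ) 1) (r : ℕ) :
    expect p (fun a => trace (dilation (centered p (toReal a)) ^ (2 * (r + 1)))) ≤
      (2 * r + 1) * expect p (fun a => ∑ k : ι × κ, (if a k then 1 - p k else p k) *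
        ((dilation (centered p (toReal a)) ^ (2 * r)) (Sum.inl k.1) (Sum.inl k.1) +
          (dilation (centered p (toReal a)) ^ (2 * r)) (Sum.inr k.2) (Sum.inr k.2))) := by
  set X : (ι × κ → Bool) → Matrix (ι ⊕ κ) (ι ⊕ κ) ℝ := fun a => dilation (centered p (toReal a))
  have hX : ∀ a, (X a).IsHermitian := fun a => isHermitian_dilation _
  set E : ι × κ → Matrix (ι ⊕ κ) (ι ⊕ κ) ℝ := fun k => dilation (single k.1 k.2 1)
  have h1 : ∀ a, trace (X a ^ (2 * (r + 1))) =
      ∑ k : ι × κ, (toReal a k - p k) * trace (E k * X a ^ (2 * r + 1)) := by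
    intro a
    have hsum : X a = ∑ k : ι × κ, (toReal a k - p k) • E k := dilation_eq_sum _
    rw [show 2 * (r + 1) = (2 * r + 1) + 1 by ring, pow_succ']
    nth_rewrite 1 [hsum]
    rw [Finset.sum_mul, trace_sum]
    simp only [smul_mul, trace_smul, smul_eq_mul]
  have h2 : ∀ k, expect p (fun a => (toReal a k - p k) * trace (E k * X a ^ (2 * r + 1))) ≤
      (2 * r + 1) * expect p (fun a => (if a k then 1 - p k else p k) *
        ((X a ^ (2 * r)) (Sum.inl k.1) (Sum.inl k.1) +
          (X a ^ (2 * r)) (Sum.inr k.2) (Sum.inr k.2))) := by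
    intro k
    have hk : 0 ≤ p k * (1 - p k) := mul_nonneg (hp k).1 (by linarith [(hp k).2])
    -- Both sides acquire the factor p(1 - p), leaving a pointwise comparison of the two matrices
    -- that differ only in entry `k`.
    rw [expect_centered_mul, expect_swap_mul p k fun a =>
      (X a ^ (2 * r)) (Sum.inl k.1) (Sum.inl k.1) + (X a ^ (2 * r)) (Sum.inr k.2) (Sum.inr k.2),
      mul_left_comm, ← expect_const_mul p (2 * (r : ℝ) + 1)]
    refine mul_le_mul_of_nonneg_left (expect_mono hp fun a => ?_) hk
    have hE : X (Function.update a k true) - X (Function.update a k false) = E k := by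
      simp only [X, E]
      rw [← dilation_sub, centered_update_sub]
    have := trace_mul_pow_sub_pow_le (hX _) (hX _) hE r
    rw [trace_dilation_single_sq_mul, trace_dilation_single_sq_mul, Matrix.mul_sub,
      trace_sub] at this
    exact this
  change expect p (fun a => trace (X a ^ (2 * (r + 1)))) ≤ _
  simp only [h1, expect_sum]
  rw [Finset.mul_sum]
  exact Finset.sum_le_sum fun k _ => h2 k

/-- A bound for the high moments of the spectral norm of a centered Bernoulli matrix. -/
theorem expect_specNorm_pow_le {p : ι × κ → ℝ} (hp : ∀ k, p k ∈ Set.Icc (0 : ℝ) 1) {R : ℝ}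
    (hrow : ∀ i, ∑ k with k.1 = i, p k ≤ R) (hcol : ∀ j, ∑ k with k.2 = j, p k ≤ R)
    {q : ℕ} (hq : q ≠ 0) (hqR : q ≤ R) :
    expect p (fun a => DMPRDPG.specNorm (centered p (toReal a)) ^ (2 * q)) ≤
      2 * ((Fintype.card ι + Fintype.card κ) * (4 * q * (Real.exp 3 * R)) ^ q) := by
  obtain ⟨r, rfl⟩ := Nat.exists_eq_succ_of_ne_zero hq
  rw [Nat.succ_eq_add_one] at *
  set X : (ι × κ → Bool) → Matrix (ι ⊕ κ) (ι ⊕ κ) ℝ := fun a => dilation (centered p (toReal a))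
  have hX : ∀ a, (X a).IsHermitian := fun a => isHermitian_dilation _
  have hR0 : 0 < R := lt_of_lt_of_le (by positivity) hqR
  set s : Finset (ι × κ) → (ι × κ → Bool) → ℝ := fun S a => ∑ k ∈ S, (toReal a k + p k)
  have hs0 : ∀ S a, 0 ≤ s S a := fun S a => Finset.sum_nonneg fun k _ => by
    have := (hp k).1
    unfold toReal
    split_ifs <;> linarith
  set c : ℝ := 2 * r + 1
  have hc0 : 0 ≤ c := by positivity
  -- This makes the weights linear in the entries, so that grouping by rows and columns gives the
  -- sums controlled by `expect_pow_sum_le`.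
  have hw : ∀ a k, (if a k then 1 - p k else p k) ≤ toReal a k + p k := by
    intro a k
    have := (hp k).1
    unfold toReal
    split_ifs <;> linarith
  have hpt : ∀ a, c * ∑ k : ι × κ, (if a k then 1 - p k else p k) *
        ((X a ^ (2 * r)) (Sum.inl k.1) (Sum.inl k.1) +
          (X a ^ (2 * r)) (Sum.inr k.2) (Sum.inr k.2)) ≤
      1 / 2 * trace (X a ^ (2 * (r + 1))) +
        ((2 * c) ^ (r + 1) * ∑ i, s {k | k.1 = i} a ^ (r + 1) +
          (2 * c) ^ (r + 1) * ∑ j, s {k | k.2 = j} a ^ (r + 1)) := by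
    intro a
    have hd := pow_two_mul_apply_self_nonneg (hX a) r
    have e1 : ∑ k : ι × κ, (toReal a k + p k) * (X a ^ (2 * r)) (Sum.inl k.1) (Sum.inl k.1) =
        ∑ i, s {k | k.1 = i} a * (X a ^ (2 * r)) (Sum.inl i) (Sum.inl i) := by
      rw [← Finset.sum_fiberwise Finset.univ Prod.fst]
      refine Finset.sum_congr rfl fun i _ => ?_
      rw [Finset.sum_mul]
      exact Finset.sum_congr rfl fun k hk => by rw [(Finset.mem_filter.1 hk).2]
    have e2 : ∑ k : ι × κ, (toReal a k + p k) * (X a ^ (2 * r)) (Sum.inr k.2) (Sum.inr k.2) =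
        ∑ j, s {k | k.2 = j} a * (X a ^ (2 * r)) (Sum.inr j) (Sum.inr j) := by
      rw [← Finset.sum_fiberwise Finset.univ Prod.snd]
      refine Finset.sum_congr rfl fun i _ => ?_
      rw [Finset.sum_mul]
      exact Finset.sum_congr rfl fun k hk => by rw [(Finset.mem_filter.1 hk).2]
    have young : ∀ S (x : ι ⊕ κ), c * (s S a * (X a ^ (2 * r)) x x) ≤
        1 / 2 * (X a ^ (2 * (r + 1))) x x + (2 * c) ^ (r + 1) * s S a ^ (r + 1) := by
      intro S x
      have := mul_pow_apply_self_le (hX a) (mul_nonneg hc0 (hs0 S a)) r x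
      rw [← mul_assoc 2, mul_pow, mul_assoc] at this
      linarith
    calc _ ≤ c * ∑ k : ι × κ, (toReal a k + p k) *
        ((X a ^ (2 * r)) (Sum.inl k.1) (Sum.inl k.1) +
          (X a ^ (2 * r)) (Sum.inr k.2) (Sum.inr k.2)) := by
          refine mul_le_mul_of_nonneg_left (Finset.sum_le_sum fun k _ => ?_) hc0
          exact mul_le_mul_of_nonneg_right (hw a k) (add_nonneg (hd _) (hd _))
      _ = ∑ i, c * (s {k | k.1 = i} a * (X a ^ (2 * r)) (Sum.inl i) (Sum.inl i)) +
          ∑ j, c * (s {k | k.2 = j} a * (X a ^ (2 * r)) (Sum.inr j) (Sum.inr j)) := by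
          simp only [mul_add, Finset.sum_add_distrib]
          rw [e1, e2, Finset.mul_sum, Finset.mul_sum]
      _ ≤ ∑ i, (1 / 2 * (X a ^ (2 * (r + 1))) (Sum.inl i) (Sum.inl i) +
            (2 * c) ^ (r + 1) * s {k | k.1 = i} a ^ (r + 1)) +
          ∑ j, (1 / 2 * (X a ^ (2 * (r + 1))) (Sum.inr j) (Sum.inr j) +
            (2 * c) ^ (r + 1) * s {k | k.2 = j} a ^ (r + 1)) :=
          add_le_add (Finset.sum_le_sum fun i _ => young _ _)
            (Finset.sum_le_sum fun j _ => young _ _)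
      _ = _ := by
          rw [trace, Fintype.sum_sum_type]
          simp only [Finset.sum_add_distrib, Finset.mul_sum, diag_apply, mul_add]
          ring
  have hmom : ∀ S, ∑ k ∈ S, p k ≤ R →
      expect p (fun a => s S a ^ (r + 1)) ≤ (Real.exp 3 * R) ^ (r + 1) :=
    fun S hS => expect_pow_sum_le hp S hS hR0 hqR
  have hrec := expect_trace_dilation_pow_le hp r
  rw [← expect_const_mul] at hrec
  replace hrec := hrec.trans (expect_mono hp hpt)
  rw [expect_add, expect_add, expect_const_mul, expect_const_mul, expect_const_mul, expect_sum,
    expect_sum] at hrec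
  have h1 : ∑ i : ι, expect p (fun a => s {k | k.1 = i} a ^ (r + 1)) ≤
      Fintype.card ι * (Real.exp 3 * R) ^ (r + 1) := by
    refine (Finset.sum_le_card_nsmul _ _ _ fun i _ => hmom _ (hrow i)).trans ?_
    simp
  have h2 : ∑ j : κ, expect p (fun a => s {k | k.2 = j} a ^ (r + 1)) ≤
      Fintype.card κ * (Real.exp 3 * R) ^ (r + 1) := by
    refine (Finset.sum_le_card_nsmul _ _ _ fun i _ => hmom _ (hcol i)).trans ?_
    simp
  have hcc : (2 * c) ^ (r + 1) ≤ (4 * ((r + 1 : ℕ) : ℝ)) ^ (r + 1) := by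
    refine pow_le_pow_left₀ (by positivity) ?_ _
    push_cast
    simp only [c]
    linarith
  have hc1 : 0 ≤ (2 * c) ^ (r + 1) := by positivity
  have hnn : 0 ≤ (Real.exp 3 * R) ^ (r + 1) := by positivity
  have h3 := mul_le_mul_of_nonneg_left h1 hc1
  have h4 := mul_le_mul_of_nonneg_left h2 hc1
  have h5 := mul_le_mul_of_nonneg_right hcc (mul_nonneg
    (by positivity : (0 : ℝ) ≤ Fintype.card ι + Fintype.card κ) hnn)
  have h6 : expect p (fun a => DMPRDPG.specNorm (centered p (toReal a)) ^ (2 * (r + 1))) ≤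
      expect p (fun a => trace (X a ^ (2 * (r + 1)))) :=
    expect_mono hp fun a => specNorm_pow_le_trace _ _ hq
  rw [mul_pow (4 * ((r + 1 : ℕ) : ℝ))]
  simp only [X] at h6 hrec
  linarith

/-- Concentration of the spectral norm of a centered Bernoulli matrix. -/
theorem prob_specNorm_ge_le [Nonempty ι] {p : ι × κ → ℝ} (hp : ∀ k, p k ∈ Set.Icc (0 : ℝ) 1)
    {R : ℝ} (hrow : ∀ i, ∑ k with k.1 = i, p k ≤ R) (hcol : ∀ j, ∑ k with k.2 = j, p k ≤ R)
    {q : ℕ} (hq : q ≠ 0) (hqR : q ≤ R) {M : ℝ} (hM : 0 ≤ M)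
    (hMq : 4 * ((Fintype.card ι + Fintype.card κ) * (4 * q * (Real.exp 3 * R)) ^ q) ≤ M ^ (2 * q))
    {t : ℝ} (ht : 0 ≤ t) :
    prob p {a | M + t ≤ DMPRDPG.specNorm (centered p (toReal a))} ≤
      2 * Real.exp (-(t ^ 2 / 16)) := by
  have hR0 : 0 < R := lt_of_lt_of_le (by positivity) hqR
  set B := 2 * ((Fintype.card ι + Fintype.card κ) * (4 * q * (Real.exp 3 * R)) ^ q)
  have hB : 0 < B := by
    have : 0 < Fintype.card ι := Fintype.card_pos
    positivity
  -- M^(2q) is at least twice the moment bound B, so Markov's inequality makes M an upper bound for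
  -- a median.
  have hmed : 1 / 2 ≤ prob p {a | DMPRDPG.specNorm (centered p (toReal a)) ≤ M} := by
    have h1 := (mul_prob_le_expect hp (φ := fun a =>
      DMPRDPG.specNorm (centered p (toReal a)) ^ (2 * q))
      (fun a => pow_nonneg (specNorm_nonneg _) _) (2 * B)).trans
      (expect_specNorm_pow_le hp hrow hcol hq hqR)
    have h2 : prob p {a | DMPRDPG.specNorm (centered p (toReal a)) ≤ M}ᶜ ≤
        prob p {a | 2 * B ≤ DMPRDPG.specNorm (centered p (toReal a)) ^ (2 * q)} := by
      refine prob_mono hp fun a ha => ?_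
      have ha' : M ≤ DMPRDPG.specNorm (centered p (toReal a)) := le_of_not_ge ha
      refine le_trans ?_ (pow_le_pow_left₀ hM ha' _)
      simp only [B]
      linarith
    rw [prob_compl] at h2
    have h3 : B * (2 * prob p {a | 2 * B ≤ DMPRDPG.specNorm (centered p (toReal a)) ^ (2 * q)}) ≤
        B * 1 := by linarith
    have h4 := le_of_mul_le_mul_left h3 hB
    linarith
  have h := prob_mul_prob_le hp (convexOn_specNorm_centered p) (specNorm_centered_sub_le p) M ht
  have h0 : 0 ≤ prob p {a | M + t ≤ DMPRDPG.specNorm (centered p (toReal a))} := by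
    have := prob_mono hp
      (Set.empty_subset {a | M + t ≤ DMPRDPG.specNorm (centered p (toReal a))})
    simpa [prob, expect] using this
  nlinarith

end Noise

end BernoulliCube

/-! ### From the random matrix model to the cube -/

namespace DMPRDPG

open BernoulliCube

variable {K T n d : ℕ}

theorem continuous_specNorm {m m' : Type*} [Fintype m] [Fintype m'] [DecidableEq m'] :
    Continuous (specNorm : Matrix m m' ℝ → ℝ) := by
  have : Continuous ((Matrix.toEuclideanLin (𝕜 := ℝ) (m := m) (n := m')).trans
      LinearMap.toContinuousLinearMap).toLinearMap :=
    LinearMap.continuous_of_finiteDimensional _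
  exact continuous_norm.comp this

/-- The probability matrix with vanishing entries on the diagonals of the blocks. -/
def offDiagProb (z : Positions K n d × Positions T n d) (k : (Fin K × Fin n) × (Fin T × Fin n)) :
    ℝ :=
  if k.1.2 = k.2.2 then 0 else dotProduct (z.1 k.1.1 k.1.2) (z.2 k.2.1 k.2.2)

theorem continuous_dotProduct_positions (k : Fin K) (i : Fin n) (t : Fin T) (j : Fin n) :
    Continuous fun z : Positions K n d × Positions T n d => dotProduct (z.1 k i) (z.2 t j) := by
  unfold dotProduct
  fun_prop

theorem continuous_offDiagProb (k : (Fin K × Fin n) × (Fin T × Fin n)) :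
    Continuous fun z : Positions K n d × Positions T n d => offDiagProb z k := by
  unfold offDiagProb
  split_ifs
  · exact continuous_const
  · exact continuous_dotProduct_positions _ _ _ _

theorem continuous_specNorm_centered_offDiagProb (x : (Fin K × Fin n) × (Fin T × Fin n) → ℝ) :
    Continuous fun z : Positions K n d × Positions T n d =>
      specNorm (centered (offDiagProb z) x) := by
  refine continuous_specNorm.comp (continuous_matrix fun i j => ?_)
  exact continuous_const.sub (continuous_offDiagProb _)

/-- Row (k, i) meets only the T columns (t, i). Cauchy–Schwarz in each row gives a squared norm of
at most KT. -/
theorem specNorm_le_of_blockDiagonal {D : Matrix (Fin K × Fin n) (Fin T × Fin n) ℝ}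
    (h0 : ∀ p q, p.2 ≠ q.2 → D p q = 0) (h1 : ∀ p q, |D p q| ≤ 1) :
    specNorm D ≤ ((max K T : ℕ) : ℝ) := by
  refine ContinuousLinearMap.opNorm_le_bound _ (Nat.cast_nonneg _) fun x => ?_
  rw [EuclideanSpace.norm_eq, EuclideanSpace.norm_eq]
  refine Real.sqrt_le_iff.2 ⟨by positivity, ?_⟩
  rw [mul_pow, Real.sq_sqrt (Finset.sum_nonneg fun _ _ => by positivity)]
  simp only [Real.norm_eq_abs, sq_abs]
  have hrow : ∀ p : Fin K × Fin n,
      ((Matrix.toEuclideanLin D).toContinuousLinearMap x) p ^ 2 ≤ T * ∑ t, x (t, p.2) ^ 2 := by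
    intro p
    have e : ((Matrix.toEuclideanLin D).toContinuousLinearMap x) p =
        ∑ t, D p (t, p.2) * x (t, p.2) := by
      change ∑ q, D p q * x q = _
      rw [Fintype.sum_prod_type]
      refine Finset.sum_congr rfl fun t _ => ?_
      refine Fintype.sum_eq_single p.2 fun j hj => ?_
      rw [h0 p (t, j) (Ne.symm hj), zero_mul]
    rw [e]
    refine (Finset.sum_mul_sq_le_sq_mul_sq _ _ _).trans ?_
    refine mul_le_mul_of_nonneg_right ?_ (Finset.sum_nonneg fun _ _ => sq_nonneg _)
    refine (Finset.sum_le_card_nsmul _ _ 1 fun t _ => (sq_le_one_iff_abs_le_one _).2 (h1 _ _)).trans ?_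
    simp
  refine (Finset.sum_le_sum fun p _ => hrow p).trans ?_
  have hx : 0 ≤ ∑ q : Fin T × Fin n, x q ^ 2 := Finset.sum_nonneg fun _ _ => sq_nonneg _
  have e : ∑ p : Fin K × Fin n, (T : ℝ) * ∑ t, x (t, p.2) ^ 2 =
      (K * T : ℝ) * ∑ q : Fin T × Fin n, x q ^ 2 := by
    rw [Fintype.sum_prod_type, Fintype.sum_prod_type]
    simp only [← Finset.mul_sum]
    rw [Finset.sum_comm (f := fun (t : Fin T) (j : Fin n) => x (t, j) ^ 2)]
    simp
    ring
  rw [e]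
  refine mul_le_mul_of_nonneg_right ?_ hx
  rw [sq]
  push_cast
  exact mul_le_mul (le_max_left _ _) (le_max_right _ _) (by positivity) (by positivity)

theorem ae_dotProduct_mem_Icc {ρ : ℝ} (hρ : 0 < ρ) {𝒳 : Fin K → Set (Fin d → ℝ)}
    {𝒴 : Fin T → Set (Fin d → ℝ)} {F : Measure (Positions K n d × Positions T n d)}
    (hF : IsLatentDistribution 𝒳 𝒴 F) {Ω : Type*} [MeasurableSpace Ω] {μ : Measure Ω}
    {A : Ω → Fin K → Fin T → Matrix (Fin n) (Fin n) ℝ}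
    {X : Ω → Positions K n d} {Y : Ω → Positions T n d}
    (hm : IsDMPRDPG μ (scaled F ρ) A X Y) :
    ∀ᵐ ω ∂μ, ∀ k i t j, dotProduct (X ω k i) (Y ω t j) ∈ Set.Icc 0 ρ := by
  have hS : MeasurableSet {z : Positions K n d × Positions T n d |
      ∀ k i t j, dotProduct (z.1 k i) (z.2 t j) ∈ Set.Icc 0 ρ} := by
    refine IsClosed.measurableSet ?_
    simp only [Set.ofPred_forall]
    exact isClosed_iInter fun k => isClosed_iInter fun i => isClosed_iInter fun t =>
      isClosed_iInter fun j => isClosed_Icc.preimage (continuous_dotProduct_positions k i t j)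
  have hW : Measurable fun ω => (X ω, Y ω) := hm.measurable_X.prodMk hm.measurable_Y
  refine (ae_map_iff hW.aemeasurable hS).1 ?_
  rw [hm.law_latent, scaled]
  have hsc : Measurable fun p : Positions K n d × Positions T n d =>
      (ρ ^ (1 / 2 : ℝ) • p.1, ρ ^ (1 / 2 : ℝ) • p.2) :=
    (by fun_prop : Continuous _).measurable
  refine (ae_map_iff hsc.aemeasurable hS).2 ?_
  filter_upwards [hF.mem_spaces] with p hp k i t j
  have h := hF.dotProduct_mem k t _ (hp.1 k i) _ (hp.2 t j)
  have hr : ρ ^ (1 / 2 : ℝ) * ρ ^ (1 / 2 : ℝ) = ρ := by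
    rw [← Real.rpow_add hρ]
    norm_num
  have e : dotProduct ((ρ ^ (1 / 2 : ℝ) • p.1) k i) ((ρ ^ (1 / 2 : ℝ) • p.2) t j) =
      ρ * dotProduct (p.1 k i) (p.2 t j) := by
    rw [Pi.smul_apply, Pi.smul_apply, Pi.smul_apply, Pi.smul_apply, smul_dotProduct,
      dotProduct_smul, smul_eq_mul, smul_eq_mul, ← mul_assoc, hr]
  change dotProduct ((ρ ^ (1 / 2 : ℝ) • p.1) k i) ((ρ ^ (1 / 2 : ℝ) • p.2) t j) ∈ _
  rw [e]
  exact ⟨mul_nonneg hρ.le h.1, by nlinarith [h.2]⟩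

/-- A diagonal coordinate has probability 0 and value `false`, hence contributes a factor 1. -/
theorem weight_offDiagProb (z : Positions K n d × Positions T n d)
    {a : (Fin K × Fin n) × (Fin T × Fin n) → Bool} (ha : ∀ k, k.1.2 = k.2.2 → a k = false) :
    weight (offDiagProb z) a =
      ∏ k, ∏ t, ∏ i, ∏ j ∈ Finset.univ.filter (fun j => i ≠ j),
        if a ((k, i), (t, j)) then dotProduct (z.1 k i) (z.2 t j)
        else 1 - dotProduct (z.1 k i) (z.2 t j) := by
  rw [weight, Fintype.prod_prod_type, Fintype.prod_prod_type]
  refine Finset.prod_congr rfl fun k _ => ?_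
  simp only [Fintype.prod_prod_type]
  rw [Finset.prod_comm]
  refine Finset.prod_congr rfl fun t _ => Finset.prod_congr rfl fun i _ => ?_
  rw [Finset.prod_filter]
  refine Finset.prod_congr rfl fun j _ => ?_
  by_cases h : i = j
  · subst h
    simp [ha ((k, i), (t, i)) rfl, offDiagProb]
  · simp [h, offDiagProb]

/-- The tail of the noise matrix is bounded by that of centered Bernoulli matrices. -/
theorem measureReal_specNorm_gt_le {ρ : ℝ} (hρ : 0 < ρ ∧ ρ ≤ 1) {𝒳 : Fin K → Set (Fin d → ℝ)}
    {𝒴 : Fin T → Set (Fin d → ℝ)} {F : Measure (Positions K n d × Positions T n d)}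
    (hF : IsLatentDistribution 𝒳 𝒴 F) {Ω : Type*} [MeasurableSpace Ω] {μ : Measure Ω}
    [IsProbabilityMeasure μ] {A : Ω → Fin K → Fin T → Matrix (Fin n) (Fin n) ℝ}
    {X : Ω → Positions K n d} {Y : Ω → Positions T n d}
    (hm : IsDMPRDPG μ (scaled F ρ) A X Y) {L δ : ℝ}
    (hL : ∀ p : (Fin K × Fin n) × (Fin T × Fin n) → ℝ, (∀ k, p k ∈ Set.Icc 0 ρ) →
      prob p {a | L ≤ specNorm (centered p (toReal a))} ≤ δ) :
    μ.real {ω | L + ((max K T : ℕ) : ℝ) < specNorm (unfold (A ω) - probMatrix (X ω) (Y ω))} ≤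
      δ := by
  classical
  set W : Ω → Positions K n d × Positions T n d := fun ω => (X ω, Y ω)
  have hW : Measurable W := hm.measurable_X.prodMk hm.measurable_Y
  set G : Finset ((Fin K × Fin n) × (Fin T × Fin n) → Bool) :=
    Finset.univ.filter fun a => ∀ k, k.1.2 = k.2.2 → a k = false
  set ev : ((Fin K × Fin n) × (Fin T × Fin n) → Bool) → Set Ω := fun a =>
    {ω | ∀ k t i j, i ≠ j → A ω k t i j = if a ((k, i), (t, j)) then 1 else 0}
  set B : ((Fin K × Fin n) × (Fin T × Fin n) → Bool) → Set (Positions K n d × Positions T n d) :=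
    fun a => {z | L ≤ specNorm (centered (offDiagProb z) (toReal a))}
  have hB : ∀ a, MeasurableSet (B a) := fun a =>
    (isClosed_le continuous_const (continuous_specNorm_centered_offDiagProb _)).measurableSet
  have hev : ∀ a, MeasurableSet (ev a) := by
    intro a
    simp only [ev, Set.ofPred_forall]
    exact MeasurableSet.iInter fun k => MeasurableSet.iInter fun t => MeasurableSet.iInter fun i =>
      MeasurableSet.iInter fun j => MeasurableSet.iInter fun _ =>
        hm.measurable_A k t i j (measurableSet_singleton _)
  have hlat := ae_dotProduct_mem_Icc hρ.1 hF hm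
  -- Replacing the block diagonals of the noise by 0 costs at most `max K T`. The bad event is then
  -- covered by the finitely many off-diagonal patterns, each joined with a condition on the latent
  -- positions alone.
  have hsub : ∀ᵐ ω ∂μ, ω ∈ {ω | L + ((max K T : ℕ) : ℝ) <
      specNorm (unfold (A ω) - probMatrix (X ω) (Y ω))} → ω ∈ ⋃ a ∈ G, ev a ∩ W ⁻¹' B a := by
    filter_upwards [hlat] with ω hω hbad
    set a : (Fin K × Fin n) × (Fin T × Fin n) → Bool := fun k =>
      decide (k.1.2 ≠ k.2.2 ∧ A ω k.1.1 k.2.1 k.1.2 k.2.2 = 1) with ha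
    set N := unfold (A ω) - probMatrix (X ω) (Y ω)
    have hN : ∀ p q, N p q = A ω p.1 q.1 p.2 q.2 - dotProduct (X ω p.1 p.2) (Y ω q.1 q.2) :=
      fun p q => rfl
    have hcen : ∀ p q, centered (offDiagProb (W ω)) (toReal a) p q =
        if p.2 = q.2 then 0 else N p q := by
      intro p q
      simp only [centered, Matrix.of_apply, offDiagProb, toReal, ha, hN, W]
      by_cases h : p.2 = q.2
      · simp [h]
      · rcases hm.binary_A ω p.1 q.1 p.2 q.2 with h' | h' <;> simp [h, h']
    have hdiag : specNorm (N - centered (offDiagProb (W ω)) (toReal a)) ≤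
        ((max K T : ℕ) : ℝ) := by
      refine specNorm_le_of_blockDiagonal (fun p q h => ?_) fun p q => ?_
      · rw [Matrix.sub_apply, hcen, if_neg h, sub_self]
      · rw [Matrix.sub_apply, hcen]
        split_ifs with h
        · have h1 := hω p.1 p.2 q.1 q.2
          rw [sub_zero, hN, abs_le]
          rcases hm.binary_A ω p.1 q.1 p.2 q.2 with h' | h' <;> rw [h'] <;>
            constructor <;> linarith [h1.1, h1.2, hρ.2]
        · simp
    refine Set.mem_iUnion₂.2 ⟨a, ?_, ?_, ?_⟩
    · simp only [G, Finset.mem_filter, Finset.mem_univ, true_and]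
      intro k hk
      simp [ha, hk]
    · intro k t i j hij
      rcases hm.binary_A ω k t i j with h | h <;> simp [ha, h, hij]
    · have h1 := specNorm_add_le (N - centered (offDiagProb (W ω)) (toReal a))
        (centered (offDiagProb (W ω)) (toReal a))
      rw [sub_add_cancel] at h1
      have h2 : L + ((max K T : ℕ) : ℝ) < specNorm N := hbad
      change L ≤ specNorm (centered (offDiagProb (W ω)) (toReal a))
      linarith
  set w : ((Fin K × Fin n) × (Fin T × Fin n) → Bool) → Ω → ℝ := fun a ω =>
    weight (offDiagProb (W ω)) a
  have hcomap : MeasurableSpace.comap W inferInstance ≤ (inferInstance : MeasurableSpace Ω) :=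
    hW.comap_le
  have hcond : ∀ a ∈ G, μ[(ev a).indicator (fun _ => (1 : ℝ)) |
      MeasurableSpace.comap W inferInstance] =ᵐ[μ] w a := by
    intro a ha
    have h := hm.cond_law_A fun k t i j => a ((k, i), (t, j))
    refine h.trans (Eventually.of_forall fun ω => ?_)
    exact (weight_offDiagProb (W ω) (Finset.mem_filter.1 ha).2).symm
  have hint : ∀ a ∈ G, Integrable (w a) μ := fun a ha =>
    integrable_condExp.congr (hcond a ha)
  -- The condition `B a` is measurable for the conditioning σ-algebra, so the defining property of
  -- the conditional expectation applies.
  have hval : ∀ a ∈ G, μ.real (ev a ∩ W ⁻¹' B a) = ∫ ω, (W ⁻¹' B a).indicator (w a) ω ∂μ := by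
    intro a ha
    have hmW : MeasurableSet[MeasurableSpace.comap W inferInstance] (W ⁻¹' B a) :=
      ⟨B a, hB a, rfl⟩
    rw [integral_indicator (hW (hB a)), ← setIntegral_congr_ae (hW (hB a))
      ((hcond a ha).mono fun ω h _ => h), setIntegral_condExp hcomap
      ((integrable_const 1).indicator (hev a)) hmW]
    change _ = ∫ ω in W ⁻¹' B a, (ev a).indicator 1 ω ∂μ
    rw [integral_indicator_one (hev a), measureReal_restrict_apply (hev a)]
  calc _ ≤ μ.real (⋃ a ∈ G, ev a ∩ W ⁻¹' B a) :=
        ENNReal.toReal_mono (measure_ne_top _ _) (measure_mono_ae hsub)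
    _ ≤ ∑ a ∈ G, μ.real (ev a ∩ W ⁻¹' B a) := measureReal_biUnion_finset_le _ _
    _ = ∫ ω, ∑ a ∈ G, (W ⁻¹' B a).indicator (w a) ω ∂μ := by
        rw [integral_finsetSum _ fun a ha => (hint a ha).indicator (hW (hB a))]
        exact Finset.sum_congr rfl hval
    _ ≤ ∫ _, δ ∂μ := by
        refine integral_mono_ae (integrable_finsetSum _ fun a ha =>
          (hint a ha).indicator (hW (hB a))) (integrable_const _) ?_
        filter_upwards [hlat] with ω hω
        have hp : ∀ k, offDiagProb (W ω) k ∈ Set.Icc 0 ρ := by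
          intro k
          unfold offDiagProb
          split_ifs
          · exact ⟨le_rfl, hρ.1.le⟩
          · exact hω _ _ _ _
        have hp1 : ∀ k, offDiagProb (W ω) k ∈ Set.Icc (0 : ℝ) 1 := fun k =>
          ⟨(hp k).1, (hp k).2.trans hρ.2⟩
        refine le_trans ?_ (hL _ hp)
        rw [prob, expect]
        have hterm : ∀ a, (W ⁻¹' B a).indicator (w a) ω = weight (offDiagProb (W ω)) a *
            Set.indicator {a | L ≤ specNorm (centered (offDiagProb (W ω)) (toReal a))}
              (fun _ => 1) a := by
          intro a
          by_cases h : W ω ∈ B a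
          · rw [Set.indicator_of_mem (show ω ∈ W ⁻¹' B a from h), Set.indicator_of_mem
              (show a ∈ {a | L ≤ specNorm (centered (offDiagProb (W ω)) (toReal a))} from h),
              mul_one]
          · rw [Set.indicator_of_notMem (show ω ∉ W ⁻¹' B a from h), Set.indicator_of_notMem
              (show a ∉ {a | L ≤ specNorm (centered (offDiagProb (W ω)) (toReal a))} from h),
              mul_zero]
        simp only [hterm]
        refine Finset.sum_le_sum_of_subset_of_nonneg (Finset.subset_univ _) fun a _ _ => ?_
        exact mul_nonneg (weight_nonneg hp1 a) (Set.indicator_nonneg (fun _ _ => zero_le_one) _)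
    _ = δ := by simp

/-! ### Choice of parameters and asymptotics -/

/-- The rate of the noise bound. -/
noncomputable def noiseRate (ρ : ℝ) (m n : ℕ) : ℝ :=
  ρ ^ (1 / 2 : ℝ) * (m : ℝ) ^ (1 / 2 : ℝ) * (n : ℝ) ^ (1 / 2 : ℝ) * Real.log n ^ (1 / 2 : ℝ)

theorem noiseRate_eq_sqrt {ρ : ℝ} (hρ : 0 ≤ ρ) (m n : ℕ) :
    noiseRate ρ m n = √(ρ * m * n * Real.log n) := by
  rw [noiseRate, Real.sqrt_eq_rpow, Real.mul_rpow (by positivity) (Real.log_natCast_nonneg n),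
    Real.mul_rpow (by positivity) (by positivity), Real.mul_rpow hρ (by positivity)]

theorem sum_filter_fst_le {ι κ : Type*} [Fintype ι] [Fintype κ] [DecidableEq ι] {ρ : ℝ}
    {p : ι × κ → ℝ} (hp : ∀ k, p k ≤ ρ) (i : ι) :
    ∑ k with k.1 = i, p k ≤ Fintype.card κ * ρ := by
  rw [Finset.sum_filter, Fintype.sum_prod_type, Fintype.sum_eq_single i]
  · simp only [if_true]
    refine (Finset.sum_le_card_nsmul _ _ ρ fun j _ => hp _).trans ?_
    simp
  · intro j hj
    simp [hj]

theorem sum_filter_snd_le {ι κ : Type*} [Fintype ι] [Fintype κ] [DecidableEq κ] {ρ : ℝ}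
    {p : ι × κ → ℝ} (hp : ∀ k, p k ≤ ρ) (j : κ) :
    ∑ k with k.2 = j, p k ≤ Fintype.card ι * ρ := by
  rw [Finset.sum_filter, Fintype.sum_prod_type_right, Fintype.sum_eq_single j]
  · simp only [if_true]
    refine (Finset.sum_le_card_nsmul _ _ ρ fun j _ => hp _).trans ?_
    simp
  · intro i hi
    simp [hi]

/-- The tail bound for centered Bernoulli matrices at the scale of the noise rate. -/
theorem prob_specNorm_centered_ge_le {K T n : ℕ} {ρ : ℝ} (hρ : 0 < ρ ∧ ρ ≤ 1) (hK : K ≠ 0)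
    (hn : 8 ≤ n) (hm : max K T ≤ n) (hlog : 4 * Real.log n ≤ √n) (hρn : √n ≤ ρ * n)
    {p : (Fin K × Fin n) × (Fin T × Fin n) → ℝ} (hp : ∀ k, p k ∈ Set.Icc 0 ρ) :
    prob p {a | (4 * Real.exp 2 + 1) * noiseRate ρ (max K T) n ≤
      specNorm (centered p (toReal a))} ≤ 2 * Real.exp (-(√n / 16)) := by
  set m := max K T
  have hm1 : 1 ≤ m := le_max_of_le_left (Nat.one_le_iff_ne_zero.2 hK)
  have hm1' : (1 : ℝ) ≤ m := by exact_mod_cast hm1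
  have hn0 : (0 : ℝ) < n := by positivity
  have hn8 : (8 : ℝ) ≤ n := by exact_mod_cast hn
  have : Nonempty (Fin K × Fin n) := ⟨(⟨0, by omega⟩, ⟨0, by omega⟩)⟩
  have hl1 : 1 ≤ Real.log n := by
    rw [Real.le_log_iff_exp_le hn0]
    linarith [Real.exp_one_lt_d9]
  set l := Real.log n
  set R := ρ * m * n
  have hR : √n ≤ R := by
    calc √n ≤ ρ * n := hρn
      _ ≤ ρ * n * m := le_mul_of_one_le_right (by have := hρ.1; positivity) hm1'
      _ = R := by simp only [R]; ring
  have hR0 : 0 < R := lt_of_lt_of_le (by positivity) hR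
  have hf : noiseRate ρ m n = √(R * l) := noiseRate_eq_sqrt hρ.1.le m n
  have hf2 : noiseRate ρ m n ^ 2 = R * l := by
    rw [hf, Real.sq_sqrt (by positivity)]
  have hf0 : 0 ≤ noiseRate ρ m n := hf ▸ Real.sqrt_nonneg _
  have hp1 : ∀ k, p k ∈ Set.Icc (0 : ℝ) 1 := fun k => ⟨(hp k).1, (hp k).2.trans hρ.2⟩
  have hKm : (K : ℝ) ≤ m := by exact_mod_cast le_max_left K T
  have hTm : (T : ℝ) ≤ m := by exact_mod_cast le_max_right K T
  have hrow : ∀ i, ∑ k with k.1 = i, p k ≤ R := by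
    intro i
    refine (sum_filter_fst_le (fun k => (hp k).2) i).trans ?_
    simp only [Fintype.card_prod, Fintype.card_fin, Nat.cast_mul, R]
    have := mul_le_mul_of_nonneg_right hTm (mul_nonneg hn0.le hρ.1.le)
    linarith
  have hcol : ∀ j, ∑ k with k.2 = j, p k ≤ R := by
    intro j
    refine (sum_filter_snd_le (fun k => (hp k).2) j).trans ?_
    simp only [Fintype.card_prod, Fintype.card_fin, Nat.cast_mul, R]
    have := mul_le_mul_of_nonneg_right hKm (mul_nonneg hn0.le hρ.1.le)
    linarith
  -- Then e^q ≥ n³ ≥ 8mn dominates four times the dimension, while q ≤ 4 log n ≤ √n ≤ R keeps the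
  -- moment bound applicable. The base becomes 16e⁴ R log n, the square of 4e² times the rate.
  set q := ⌈3 * l⌉₊
  have hq1 : 3 * l ≤ q := Nat.le_ceil _
  have hq2 : (q : ℝ) ≤ 4 * l := by
    have := Nat.ceil_lt_add_one (a := 3 * l) (by positivity)
    linarith
  have hq0 : q ≠ 0 := by
    rintro h
    rw [h] at hq1
    norm_num at hq1
    linarith
  have hqR : (q : ℝ) ≤ R := by linarith
  have hMq : 4 * ((Fintype.card (Fin K × Fin n) + Fintype.card (Fin T × Fin n)) *
      (4 * q * (Real.exp 3 * R)) ^ q) ≤ (4 * Real.exp 2 * noiseRate ρ m n) ^ (2 * q) := by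
    have hdim : 4 * ((Fintype.card (Fin K × Fin n) + Fintype.card (Fin T × Fin n) : ℝ)) ≤
        Real.exp 1 ^ q := by
      have hmn : (m : ℝ) ≤ n := by exact_mod_cast hm
      calc _ ≤ (8 : ℝ) * (m * n) := by
            simp only [Fintype.card_prod, Fintype.card_fin, Nat.cast_mul]
            have h1 := mul_le_mul_of_nonneg_right hKm hn0.le
            have h2 := mul_le_mul_of_nonneg_right hTm hn0.le
            linarith
        _ ≤ n * (n * n) := by gcongr
        _ = Real.exp l ^ 3 := by
            rw [Real.exp_log hn0]
            ring
        _ = Real.exp (3 * l) := by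
            rw [← Real.exp_nat_mul]
            norm_num
        _ ≤ Real.exp q := Real.exp_le_exp.2 hq1
        _ = Real.exp 1 ^ q := by rw [← Real.exp_nat_mul, mul_one]
    calc _ = 4 * ((Fintype.card (Fin K × Fin n) + Fintype.card (Fin T × Fin n) : ℝ)) *
          (4 * q * (Real.exp 3 * R)) ^ q := by ring
      _ ≤ Real.exp 1 ^ q * (4 * (4 * l) * (Real.exp 3 * R)) ^ q := by gcongr
      _ = (16 * Real.exp 4 * (R * l)) ^ q := by
          rw [← mul_pow, show (4 : ℝ) = 1 + 3 by norm_num, Real.exp_add]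
          ring
      _ = _ := by
          rw [pow_mul, mul_pow _ (noiseRate ρ m n), hf2, mul_pow 4, ← Real.exp_nat_mul]
          norm_num
  have h := prob_specNorm_ge_le hp1 hrow hcol hq0 hqR
    (by positivity : 0 ≤ 4 * Real.exp 2 * noiseRate ρ m n) hMq hf0
  rw [hf2] at h
  rw [add_mul, one_mul]
  refine h.trans ?_
  have : √n ≤ R * l := hR.trans (le_mul_of_one_le_right hR0.le hl1)
  gcongr

theorem exp_neg_sqrt_div_le (γ : ℝ) :
    ∃ C : ℝ, 0 < C ∧ ∀ n : ℕ, 1 ≤ n → 2 * Real.exp (-(√n / 16)) ≤ C * (n : ℝ) ^ (-γ) := by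
  -- The k-th term of the exponential series at √n/16 already dominates n^γ = (√n)^(2γ) up to a
  -- constant.
  set k := ⌈2 * γ⌉₊
  refine ⟨2 * (16 ^ k * k.factorial), by positivity, fun n hn => ?_⟩
  have hn1 : (1 : ℝ) ≤ n := by exact_mod_cast hn
  have h := Real.pow_div_factorial_le_exp (√n / 16) (by positivity) k
  have hk : (n : ℝ) ^ γ ≤ √n ^ k := by
    rw [Real.sqrt_eq_rpow, ← Real.rpow_natCast, ← Real.rpow_mul (by positivity)]
    refine Real.rpow_le_rpow_of_exponent_le hn1 ?_
    have := Nat.le_ceil (2 * γ)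
    linarith
  have h2 : (n : ℝ) ^ γ ≤ 16 ^ k * k.factorial * Real.exp (√n / 16) := by
    rw [div_pow, div_div, div_le_iff₀ (by positivity)] at h
    linarith
  rw [Real.exp_neg, Real.rpow_neg (by positivity), mul_assoc]
  refine mul_le_mul_of_nonneg_left ?_ zero_le_two
  rw [← div_eq_mul_inv, le_div_iff₀ (by positivity), ← div_eq_inv_mul,
    div_le_iff₀ (Real.exp_pos _)]
  exact h2

theorem eventually_four_mul_log_le_sqrt : ∀ᶠ n : ℕ in atTop, 4 * Real.log n ≤ √n := by
  have h := ((isLittleO_log_rpow_atTop (r := 1 / 2) (by norm_num)).bound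
    (c := 1 / 4) (by norm_num)).natCast_atTop
  filter_upwards [h, eventually_ge_atTop 1] with n hn h1
  rw [Real.norm_of_nonneg (Real.log_natCast_nonneg n), Real.norm_of_nonneg (by positivity),
    ← Real.sqrt_eq_rpow] at hn
  linarith

/-- Of the growth condition only ρ ≥ n^(-1/2) is kept; the power of the logarithm is at least 1 once
n ≥ 3. -/
theorem eventually_sqrt_le_mul {ρ : ℕ → ℝ} (hρ : ∀ n, 0 < ρ n) {c : ℝ} (hc : 0 ≤ c)
    (h : (fun n : ℕ => Real.log n ^ c * (n : ℝ) ^ (-(1 / 2) : ℝ)) =o[atTop] ρ) :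
    ∀ᶠ n : ℕ in atTop, √n ≤ ρ n * n := by
  filter_upwards [h.bound (c := 1) one_pos, eventually_ge_atTop 3] with n hn h3
  have hn3 : (3 : ℝ) ≤ n := by exact_mod_cast h3
  have hn0 : (0 : ℝ) < n := by linarith
  have hl : 1 ≤ Real.log n := by
    rw [Real.le_log_iff_exp_le hn0]
    linarith [Real.exp_one_lt_d9]
  have h1 : 1 ≤ Real.log n ^ c := Real.one_le_rpow hl hc
  rw [Real.norm_of_nonneg (by positivity), Real.norm_of_nonneg (hρ n).le, one_mul] at hn
  have h2 : (n : ℝ) ^ (-(1 / 2) : ℝ) ≤ ρ n :=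
    (le_mul_of_one_le_left (by positivity) h1).trans hn
  calc √n = (n : ℝ) ^ (-(1 / 2) : ℝ) * n := by
        rw [Real.sqrt_eq_rpow]
        nth_rewrite 3 [← Real.rpow_one (n : ℝ)]
        rw [← Real.rpow_add hn0]
        norm_num
    _ ≤ ρ n * n := by gcongr

theorem specNorm_eq_zero_of_isEmpty {m m' : Type*} [Fintype m] [Fintype m'] [DecidableEq m']
    [IsEmpty (m × m')] (M : Matrix m m' ℝ) : specNorm M = 0 := by
  have := specNorm_le_sqrt_sum_sq M
  rw [Finset.univ_eq_empty, Finset.sum_empty, Real.sqrt_zero] at this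
  exact le_antisymm this (specNorm_nonneg M)

end DMPRDPG

theorem proposition2 {d : ℕ} (K T : ℕ → ℕ) (ρ : ℕ → ℝ)
    (hKT : (fun n : ℕ => ((max (K n) (T n) : ℕ) : ℝ)) =O[atTop] fun n : ℕ => Real.log n)
    (hρ : ∀ n, 0 < ρ n ∧ ρ n ≤ 1)
    (hρ_growth : ∃ c : ℝ, 4 ≤ c ∧
      (fun n : ℕ => Real.log n ^ c * (n : ℝ) ^ (-(1 / 2) : ℝ)) =o[atTop] ρ)
    (𝒳 : ∀ n, Fin (K n) → Set (Fin d → ℝ)) (𝒴 : ∀ n, Fin (T n) → Set (Fin d → ℝ))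
    (F : ∀ n, Measure (DMPRDPG.Positions (K n) n d × DMPRDPG.Positions (T n) n d))
    (hF : ∀ n, DMPRDPG.IsLatentDistribution (𝒳 n) (𝒴 n) (F n))
    {Ω : ℕ → Type*} [∀ n, MeasurableSpace (Ω n)]
    (μ : ∀ n, Measure (Ω n)) [∀ n, IsProbabilityMeasure (μ n)]
    (A : ∀ n, Ω n → Fin (K n) → Fin (T n) → Matrix (Fin n) (Fin n) ℝ)
    (X : ∀ n, Ω n → DMPRDPG.Positions (K n) n d) (Y : ∀ n, Ω n → DMPRDPG.Positions (T n) n d)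
    (hmodel : ∀ n, DMPRDPG.IsDMPRDPG (μ n) (DMPRDPG.scaled (F n) (ρ n)) (A n) (X n) (Y n)) :
    DMPRDPG.IsBigOP μ
      (fun n ω => DMPRDPG.specNorm
        (DMPRDPG.unfold (A n ω) - DMPRDPG.probMatrix (X n ω) (Y n ω)))
      (fun n => ρ n ^ (1 / 2 : ℝ) * ((max (K n) (T n) : ℕ) : ℝ) ^ (1 / 2 : ℝ) *
        (n : ℝ) ^ (1 / 2 : ℝ) * Real.log n ^ (1 / 2 : ℝ)) := by
  obtain ⟨c, hc, hρc⟩ := hρ_growth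
  obtain ⟨b, hb0, hb⟩ := hKT.exists_pos
  have hsmall : ∀ᶠ n : ℕ in atTop, b * Real.log n ≤ n := by
    have h := (Real.isLittleO_log_id_atTop.bound (c := 1 / b) (by positivity)).natCast_atTop
    filter_upwards [h] with n hn
    rw [Real.norm_of_nonneg (Real.log_natCast_nonneg n), id, Real.norm_natCast, one_div,
      ← div_eq_inv_mul, le_div_iff₀ hb0] at hn
    linarith
  obtain ⟨N, hN⟩ := eventually_atTop.1 (hb.bound.and (hsmall.and
    (DMPRDPG.eventually_four_mul_log_le_sqrt.and
      (DMPRDPG.eventually_sqrt_le_mul (fun n => (hρ n).1) (by linarith) hρc))))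
  -- The summands account for the median bound, the deviation and the block diagonals. The constant
  -- is fixed before γ.
  refine ⟨max N 8, 4 * Real.exp 2 + 1 + √b, by positivity, fun γ _ => ?_⟩
  obtain ⟨C, hC, hCn⟩ := DMPRDPG.exp_neg_sqrt_div_le γ
  refine ⟨C, hC, fun n hn => ?_⟩
  obtain ⟨h1, h2, h3, h4⟩ := hN n ((le_max_left _ _).trans hn)
  have hn8 : 8 ≤ n := (le_max_right _ _).trans hn
  have hCnn : 0 ≤ C * (n : ℝ) ^ (-γ) := by positivity
  have hrate0 : 0 ≤ DMPRDPG.noiseRate (ρ n) (max (K n) (T n)) n := by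
    rw [DMPRDPG.noiseRate_eq_sqrt (hρ n).1.le]
    exact Real.sqrt_nonneg _
  change _ ≤ (μ n).real {ω | |DMPRDPG.specNorm _| ≤
    (4 * Real.exp 2 + 1 + √b) * DMPRDPG.noiseRate (ρ n) (max (K n) (T n)) n}
  rcases Nat.eq_zero_or_pos (K n) with hK | hK
  · have : IsEmpty (Fin (K n)) := by rw [hK]; infer_instance
    have : {ω | |DMPRDPG.specNorm (DMPRDPG.unfold (A n ω) - DMPRDPG.probMatrix (X n ω) (Y n ω))| ≤
        (4 * Real.exp 2 + 1 + √b) * DMPRDPG.noiseRate (ρ n) (max (K n) (T n)) n} = Set.univ := by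
      refine Set.eq_univ_of_forall fun ω => ?_
      change |DMPRDPG.specNorm _| ≤ _
      rw [DMPRDPG.specNorm_eq_zero_of_isEmpty, abs_zero]
      positivity
    rw [this, probReal_univ]
    linarith
  · have hl0 := Real.log_natCast_nonneg n
    rw [Real.norm_natCast, Real.norm_of_nonneg hl0] at h1
    have hmn : max (K n) (T n) ≤ n := by exact_mod_cast h1.trans h2
    have htail := DMPRDPG.measureReal_specNorm_gt_le (hρ n) (hF n) (hmodel n) fun p hp =>
      DMPRDPG.prob_specNorm_centered_ge_le (hρ n) hK.ne' hn8 hmn h3 h4 hp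
    -- With m the maximum, m² ≤ (b log n)·m ≤ b·ρmn log n.
    have hdiag : ((max (K n) (T n) : ℕ) : ℝ) ≤
        √b * DMPRDPG.noiseRate (ρ n) (max (K n) (T n)) n := by
      rw [DMPRDPG.noiseRate_eq_sqrt (hρ n).1.le, ← Real.sqrt_mul hb0.le]
      refine Real.le_sqrt_of_sq_le ?_
      have hρn1 : 1 ≤ ρ n * n := by
        refine le_trans ?_ h4
        rw [Real.one_le_sqrt]
        exact_mod_cast le_trans (by norm_num) hn8
      have hm0 : (0 : ℝ) ≤ ((max (K n) (T n) : ℕ) : ℝ) := Nat.cast_nonneg _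
      calc _ = ((max (K n) (T n) : ℕ) : ℝ) * ((max (K n) (T n) : ℕ) : ℝ) := sq _
        _ ≤ (b * Real.log n) * ((max (K n) (T n) : ℕ) : ℝ) := by gcongr
        _ ≤ (b * Real.log n) * ((max (K n) (T n) : ℕ) : ℝ) * (ρ n * n) :=
            le_mul_of_one_le_right (by positivity) hρn1
        _ = _ := by ring
    set S := {ω | (4 * Real.exp 2 + 1) * DMPRDPG.noiseRate (ρ n) (max (K n) (T n)) n +
      ((max (K n) (T n) : ℕ) : ℝ) <
      DMPRDPG.specNorm (DMPRDPG.unfold (A n ω) - DMPRDPG.probMatrix (X n ω) (Y n ω))}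
    have hcover : 1 ≤ (μ n).real {ω | |DMPRDPG.specNorm
        (DMPRDPG.unfold (A n ω) - DMPRDPG.probMatrix (X n ω) (Y n ω))| ≤
        (4 * Real.exp 2 + 1 + √b) * DMPRDPG.noiseRate (ρ n) (max (K n) (T n)) n} +
        (μ n).real S := by
      refine (probReal_univ (μ := μ n)).symm.le.trans
        ((measureReal_mono fun ω _ => ?_).trans (measureReal_union_le _ _))
      rcases le_or_gt (DMPRDPG.specNorm (DMPRDPG.unfold (A n ω) - DMPRDPG.probMatrix (X n ω) (Y n ω)))
        ((4 * Real.exp 2 + 1) * DMPRDPG.noiseRate (ρ n) (max (K n) (T n)) n +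
          ((max (K n) (T n) : ℕ) : ℝ)) with h | h
      · left
        change |DMPRDPG.specNorm _| ≤ _
        rw [abs_of_nonneg (BernoulliCube.specNorm_nonneg _)]
        linarith
      · exact Or.inr h
    have := hCn n (by omega)
    linarith
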